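/- Let $T$ be a complete first-order theory in a language $L$ and let $\bar M$ be a monster model of $T$: for a cardinal $\kappa>|L|+\aleph_0$, $\bar M$ is $\kappa$-saturated and strongly $\kappa$-homogeneous; "small" means "of cardinality $<\kappa$". A global type is a complete type $\mathfrak p(\bar x)$ over $\bar M$ in finitely many variables; $\mathfrak p_{\upharpoonright A}$ is its restriction to $A\subseteq\bar M$. Definitions. - $\mathfrak p$ is $A$-invariant if, whenever finite tuples $\bar b_1,\bar b_2$ of $\bar M$ have the same type over $A$, $(\phi(\bar x,\bar b_1)\Leftrightarrow\phi(\bar x,\bar b_2))\in\mathfrak p$ for every formula $\phi(\bar x,\bar y)$ over $A$. A pair $(\mathfrak p,\phi)$ is $A$-invariant if $\mathfrak p$ is $A$-invariant and $\phi\in\mathfrak p_{\upharpoonright A}$. - $(\bar a_i\mid i<\alpha)$ is a Morley sequence in $\mathfrak p$ over $A$ if $\bar a_i\models\mathfrak p_{\upharpoonright A\bar a_{<i}}$ for all $i<\alpha$. - $\mathfrak p$ is generically stable if it is non-algebraic (no formula in $\mathfrak p$ has only finitely many solutions) and, for some small $A$, $\mathfrak p$ is $A$-invariant and for every infinite ordinal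 $\alpha$, every Morley sequence $(\bar a_i\mid i<\alpha)$ in $\mathfrak p$ over $A$ and every formula $\phi(\bar x)$ with parameters from $\bar M$, the set $\{i<\alpha:\ \models\phi(\bar a_i)\}$ is finite or co-finite. - $(\mathfrak p,\phi)$ is strongly regular if for some small $A$ it is an $A$-invariant pair and for all small $B\supseteq A$ and all $\bar a$ satisfying $\phi$: either $\bar a\models\mathfrak p_{\upharpoonright B}$ or $\mathfrak p_{\upharpoonright B}\vdash\mathfrak p_{\upharpoonright B\bar a}$. - Complete types $p(\bar x),q(\bar y)$ over the same set are weakly orthogonal, $p\perp^{w}q$, if $p(\bar x)\cup q(\bar y)$ determines a complete type in $\bar x,\bar y$ over that set. Global types are orthogonal, $\mathfrak p\perp\mathfrak q$, if they are weakly orthogonal as types over $\bar M$. Theorem. Let $M\preceq\bar M$ be a small elementary submodel, and let $(\mathfrak p(\bar x),\phi_{\mathfrak p}(\bar x))$ and $(\mathfrak q(\bar y),\phi_{\mathfrak q}(\bar y))$ be $M$-invariant pairs which are strongly regular, with $\mathfrak p$ and $\mathfrak q$ generically stable. Then the following are equivalent: (1) $\mathfrak p\perp\mathfrak q$; (2)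 $\mathfrak p_{\upharpoonright M}\perp^{w}\mathfrak q_{\upharpoonright M}$; (3) for some small $C\supseteq M$: $\mathfrak p_{\upharpoonright C}\perp^{w}\mathfrak q_{\upharpoonright C}$. -/

import Mathlib

open FirstOrder Cardinal

universe u v w w₁ w₂

namespace MonsterTypes

open FirstOrder.Language

section General

variable {L : FirstOrder.Language.{u, v}} {T : L.Theory} {α : Type w₁} {β : Type w₂}

/-- Complete types `p(x)` and `q(y)` over the same domain, in disjoint tuples of variables `x`
and `y`, are weakly orthogonal if the set of formulas `p(x) ∪ q(y)` determines a complete type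
in the variables `x, y`. -/
def WeaklyOrthogonal (p : T.CompleteType α) (q : T.CompleteType β) : Prop :=
  Theory.IsComplete
    ((L.lhomWithConstantsMap (Sum.inl : α → α ⊕ β)).onTheory (p : L[[α]].Theory) ∪
      (L.lhomWithConstantsMap (Sum.inr : β → α ⊕ β)).onTheory (q : L[[β]].Theory))

end General

variable (L : FirstOrder.Language.{u, v}) (𝕄 : Type w) [L.Structure 𝕄]

/-- `S_α(A)`: the complete types over the parameter set `A ⊆ 𝕄`, in variables indexed by `α`. -/
abbrev TypeOver (A : Set 𝕄) (α : Type w₁) :=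
  ((L[[A]]).completeTheory 𝕄).CompleteType α

/-- Global types: the complete types over the whole of `𝕄`. -/
abbrev GlobalType (α : Type w₁) :=
  TypeOver L 𝕄 Set.univ α

/-- Formulas with parameters from `𝕄`, in variables indexed by `α`. -/
abbrev GlobalFormula (α : Type w₁) :=
  (L[[(Set.univ : Set 𝕄)]]).Formula α

/-- `𝕄` is `κ`-saturated: every complete 1-type over fewer than `κ` parameters is realized. -/
def IsSaturated [Nonempty 𝕄] (κ : Cardinal.{w}) : Prop :=
  ∀ A : Set 𝕄, #A < κ → ∀ p : TypeOver L 𝕄 A (Fin 1),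
    p ∈ ((L[[A]]).completeTheory 𝕄).realizedTypes 𝕄 (Fin 1)

/-- `𝕄` is strongly `κ`-homogeneous: every elementary map from a subset of size less than `κ`
into `𝕄` extends to an automorphism of `𝕄`. -/
def IsStronglyHomogeneous (κ : Cardinal.{w}) : Prop :=
  ∀ A : Set 𝕄, #A < κ → ∀ f : A → 𝕄,
    (∀ φ : L.Formula A, φ.Realize (fun a : A => (a : 𝕄)) ↔ φ.Realize f) →
      ∃ σ : 𝕄 ≃[L] 𝕄, ∀ a : A, σ a = f a

/-- `𝕄` is a monster model with smallness bound `κ`: the cardinal `κ` exceeds `ℵ₀` and the size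
of the language, and `𝕄` is `κ`-saturated and strongly `κ`-homogeneous. "Small" means "of
cardinality less than `κ`". -/
structure IsMonster [Nonempty 𝕄] (κ : Cardinal.{w}) : Prop where
  aleph0_lt : ℵ₀ < κ
  card_lt : Cardinal.lift.{w} L.card < Cardinal.lift.{max u v} κ
  saturated : IsSaturated L 𝕄 κ
  homogeneous : IsStronglyHomogeneous L 𝕄 κ

variable {L 𝕄}

/-- The language map that regards parameters from `A` as parameters from `𝕄`. -/
abbrev toGlobal (L : FirstOrder.Language.{u, v}) {𝕄 : Type w} (A : Set 𝕄) :
    L[[A]] →ᴸ L[[(Set.univ : Set 𝕄)]] :=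
  L.lhomWithConstantsMap (Set.inclusion (Set.subset_univ A))

/-- The restriction of a global type to the parameter set `A`: the set of all formulas over `A`
that belong to the type. -/
def restrict {α : Type w₁} (p : GlobalType L 𝕄 α) (A : Set 𝕄) : TypeOver L 𝕄 A α where
  toTheory := {ψ | ((toGlobal L A).addConstants α).onSentence ψ ∈ p}
  subset' := by
    rintro _ ⟨ψ, hψ, rfl⟩
    refine p.subset ⟨(toGlobal L A).onSentence ψ, ?_, ?_⟩
    · exact ((toGlobal L A).realize_onSentence 𝕄 ψ).2 hψ
    · have h := congrArg (fun g => LHom.onBoundedFormula g ψ)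
        (LHom.sumMap_comp_inl (toGlobal L A) (LHom.id (constantsOn α)))
      simp only [LHom.comp_onBoundedFormula, Function.comp_apply] at h
      exact h.symm
  isMaximal' := by
    refine ⟨?_, fun ψ => ?_⟩
    · refine Theory.isSatisfiable_of_isSatisfiable_onTheory ((toGlobal L A).addConstants α)
        (p.isMaximal.1.mono ?_)
      rintro _ ⟨ψ, hψ, rfl⟩
      exact hψ
    · exact p.mem_or_not_mem (((toGlobal L A).addConstants α).onSentence ψ)

/-- The formula `φ` (with parameters) belongs to the type `p`. -/
def FormulaMem {A : Set 𝕄} {α : Type w₁} (φ : (L[[A]]).Formula α) (p : TypeOver L 𝕄 A α) : Prop :=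
  Formula.equivSentence φ ∈ p

/-- `a ⊨ p`: the tuple `a` of elements of `𝕄` realizes the type `p` over `A`. -/
def Realizes [Nonempty 𝕄] {A : Set 𝕄} {α : Type w₁} (a : α → 𝕄) (p : TypeOver L 𝕄 A α) : Prop :=
  ((L[[A]]).completeTheory 𝕄).typeOf a = p

/-- The instance `φ(x, b)` of a formula `φ(x, y)` over `A`, for a tuple `b` of elements
of `𝕄`. -/
def instanceAt {A : Set 𝕄} {α : Type w₁} {k : ℕ} (φ : (L[[A]]).Formula (α ⊕ Fin k))
    (b : Fin k → 𝕄) : GlobalFormula L 𝕄 α :=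
  BoundedFormula.subst ((toGlobal L A).onFormula φ)
    (Sum.elim Term.var fun j => Constants.term (L.con (⟨b j, trivial⟩ : (Set.univ : Set 𝕄))))

/-- `p` is `A`-invariant: if `b₁` and `b₂` have the same type over `A`, then
`φ(x, b₁) ↔ φ(x, b₂)` belongs to `p` for every formula `φ(x, y)` over `A`. -/
def IsInvariant [Nonempty 𝕄] {α : Type w₁} (A : Set 𝕄) (p : GlobalType L 𝕄 α) : Prop :=
  ∀ (k : ℕ) (b₁ b₂ : Fin k → 𝕄),
    ((L[[A]]).completeTheory 𝕄).typeOf b₁ = ((L[[A]]).completeTheory 𝕄).typeOf b₂ →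
      ∀ φ : (L[[A]]).Formula (α ⊕ Fin k),
        FormulaMem (BoundedFormula.iff (instanceAt φ b₁) (instanceAt φ b₂)) p

/-- `(p, φ)` is an `A`-invariant pair: `p` is `A`-invariant, and `φ` is a formula over `A`
which belongs to the restriction of `p` to `A`. -/
def IsInvariantPair [Nonempty 𝕄] {α : Type w₁} (A : Set 𝕄) (p : GlobalType L 𝕄 α)
    (φ : GlobalFormula L 𝕄 α) : Prop :=
  IsInvariant A p ∧
    ∃ ψ : (L[[A]]).Formula α, (toGlobal L A).onFormula ψ = φ ∧ FormulaMem ψ (restrict p A)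

/-- `p` is non-algebraic: no formula in `p` has only finitely many solutions. -/
def IsNonalgebraic {α : Type w₁} (p : GlobalType L 𝕄 α) : Prop :=
  ∀ φ : GlobalFormula L 𝕄 α, FormulaMem φ p → {a : α → 𝕄 | φ.Realize a}.Infinite

/-- `(a i | i < o)` is a Morley sequence in `p` over `A`: each `a i` realizes the restriction
of `p` to `A` together with all the earlier elements of the sequence. -/
def IsMorleySequence [Nonempty 𝕄] {α : Type w₁} (A : Set 𝕄) (p : GlobalType L 𝕄 α)
    {o : Ordinal.{w}} (a : Set.Iio o → α → 𝕄) : Prop :=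
  ∀ i : Set.Iio o,
    Realizes (a i) (restrict p (A ∪ {c | ∃ j : Set.Iio o, j < i ∧ c ∈ Set.range (a j)}))

/-- `p` is generically stable. -/
def IsGenericallyStable [Nonempty 𝕄] {α : Type w₁} (κ : Cardinal.{w}) (p : GlobalType L 𝕄 α) :
    Prop :=
  IsNonalgebraic p ∧
    ∃ A : Set 𝕄, #A < κ ∧ IsInvariant A p ∧
      ∀ o : Ordinal.{w}, Ordinal.omega0 ≤ o → ∀ a : Set.Iio o → α → 𝕄, IsMorleySequence A p a →
        ∀ φ : GlobalFormula L 𝕄 α,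
          {i | φ.Realize (a i)}.Finite ∨ {i | ¬ φ.Realize (a i)}.Finite

/-- `(p, φ)` is strongly regular: for some small `A` it is an `A`-invariant pair, and for all
small `B ⊇ A` and all `a` satisfying `φ`, either `a` realizes `p ↾ B`, or
`p ↾ B ⊢ p ↾ (B ∪ a)`, that is, every realization of `p ↾ B` realizes `p ↾ (B ∪ a)`. -/
def IsStronglyRegular [Nonempty 𝕄] {α : Type w₁} (κ : Cardinal.{w}) (p : GlobalType L 𝕄 α)
    (φ : GlobalFormula L 𝕄 α) : Prop :=
  ∃ A : Set 𝕄, #A < κ ∧ IsInvariantPair A p φ ∧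
    ∀ B : Set 𝕄, A ⊆ B → #B < κ → ∀ a : α → 𝕄, φ.Realize a →
      Realizes a (restrict p B) ∨
        ∀ a' : α → 𝕄, Realizes a' (restrict p B) → Realizes a' (restrict p (B ∪ Set.range a))

/-- Global types are orthogonal if they are weakly orthogonal as complete types over `𝕄`. -/
def Orthogonal {α : Type w₁} {β : Type w₂} (p : GlobalType L 𝕄 α) (q : GlobalType L 𝕄 β) : Prop :=
  WeaklyOrthogonal p q

end MonsterTypes

open MonsterTypes

/-! Everything is phrased with definable sets. Two types over the same set are weakly orthogonal iff
every relation R(x, y) definable over that set contains or misses some product S × S', with S in the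
first type and S' in the second (`weaklyOrthogonal_iff`).

For (1) ⇒ (2) and (3) ⇒ (2): a generically stable type is definable over every small set over which
it is invariant (`definable_defMem`). That S and S' exist, with whatever parameters, is then a
first-order condition over M on these parameters, so the elementary submodel M already contains
suitable ones.

For (2) ⇒ (1): if orthogonality fails, some R(x, y, d) and its complement both meet every S × S'.
Let N be a small set containing M, d and the other relevant parameters, and let b realize q over N.
By `defMem_of_meets` the fibers over b of R and of its complement both belong to p, which is absurd.
To see that the fiber R(x, b, d) is in p, suppose it is not. Definability of p moves d to some d' in
M and gives each realization a of p over M a partner b' in φ_q such that R(a, b', d') holds but R(x,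
b', d') is not in p. Hence a is not generic over M b', and weak orthogonality over M prevents b'
from realizing q over M. Now choose a_i in the fiber over b, generic over N b'_{<i}, with partner
b'_i. Regularity of q keeps b generic over N b'_{<i}, so the choice can continue. Regularity of p
makes a_i generic over N a_{<i}, because each earlier a_j is not generic over its own partner. So
the a_i form a Morley sequence inside the fiber, and generic stability
(`exists_forall_isMorleyOn_defMem`) puts the fiber in p. -/

namespace MonsterTypes

open FirstOrder.Language

set_option linter.unusedSectionVars false

/-! ### From formulas in types to definable sets -/

section Bridge

variable {L : FirstOrder.Language.{u, v}} {𝕄 : Type w} [L.Structure 𝕄] [Nonempty 𝕄]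
  {A : Set 𝕄} {α : Type w₁} {β : Type w₂}

/-- The set `S` is defined by a formula that belongs to the type `P`. -/
def DefMem (P : TypeOver L 𝕄 A α) (S : Set (α → 𝕄)) : Prop :=
  ∃ φ : (L[[A]]).Formula α, FormulaMem φ P ∧ S = {v | φ.Realize v}

/-- With finitely many variables, solvability is a single sentence of the complete theory. Thus
consistency of a formula with a type can be tested in `𝕄` without saturation, even when the
parameter set is all of `𝕄`. -/
theorem exists_realize_of_mem_model [Finite α] {φ : (L[[A]]).Formula α}
    (N : Type*) [(L[[A]]).Structure N] [N ⊨ (L[[A]]).completeTheory 𝕄] (v : α → N)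
    (hv : φ.Realize v) : ∃ a : α → 𝕄, φ.Realize a := by
  by_contra! h
  let χ : (L[[A]]).Sentence :=
    ((φ.relabel (Sum.inr : α → Empty ⊕ α)).iExs α : (L[[A]]).Formula Empty)
  have hχ : χ.not ∈ (L[[A]]).completeTheory 𝕄 := by
    rw [mem_completeTheory, Sentence.realize_not]
    intro hc
    have hc' := (Formula.realize_iExs (L := L[[A]])).1 hc
    obtain ⟨i, hi⟩ := hc'
    exact h i (by simpa [Formula.realize_relabel] using hi)
  have := Theory.realize_sentence_of_mem (M := N) _ hχ
  rw [Sentence.realize_not] at this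
  exact this ((Formula.realize_iExs (L := L[[A]])).2 ⟨v, by
    simpa [Formula.realize_relabel] using hv⟩)

theorem exists_realize_of_formulaMem [Finite α] {P : TypeOver L 𝕄 A α} {φ : (L[[A]]).Formula α}
    (h : FormulaMem φ P) : ∃ a : α → 𝕄, φ.Realize a := by
  obtain ⟨N, v, hv⟩ := Theory.exists_modelType_is_realized_in _ P
  unfold FormulaMem at h
  rw [← hv, Theory.CompleteType.formula_mem_typeOf] at h
  exact exists_realize_of_mem_model N v h

theorem formulaMem_not {P : TypeOver L 𝕄 A α} {φ : (L[[A]]).Formula α} :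
    FormulaMem φ.not P ↔ ¬ FormulaMem φ P := by
  unfold FormulaMem
  rw [Formula.equivSentence_not]
  exact P.not_mem_iff _

theorem formulaMem_inf {P : TypeOver L 𝕄 A α} {φ ψ : (L[[A]]).Formula α} :
    FormulaMem (φ ⊓ ψ) P ↔ FormulaMem φ P ∧ FormulaMem ψ P := by
  unfold FormulaMem
  rw [Formula.equivSentence_inf]
  exact Set.ext_iff.1 (Theory.CompleteType.typesWith_inf (Formula.equivSentence φ)
    (Formula.equivSentence ψ)) P

theorem FormulaMem.mono [Finite α] {P : TypeOver L 𝕄 A α} {φ ψ : (L[[A]]).Formula α}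
    (h : FormulaMem φ P) (hψ : ∀ v : α → 𝕄, φ.Realize v → ψ.Realize v) : FormulaMem ψ P := by
  by_contra hn
  obtain ⟨v, hv⟩ := exists_realize_of_formulaMem (formulaMem_inf.2 ⟨h, formulaMem_not.2 hn⟩)
  rw [Formula.realize_inf, Formula.realize_not] at hv
  exact hv.2 (hψ v hv.1)

namespace DefMem

variable {P : TypeOver L 𝕄 A α} {S S' : Set (α → 𝕄)}

theorem definable (h : DefMem P S) : A.Definable L S :=
  let ⟨φ, _, hS⟩ := h
  ⟨φ, hS⟩

theorem formulaMem_iff [Finite α] {φ : (L[[A]]).Formula α} :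
    DefMem P {v | φ.Realize v} ↔ FormulaMem φ P := by
  refine ⟨?_, fun h => ⟨φ, h, rfl⟩⟩
  rintro ⟨ψ, hψ, h⟩
  exact hψ.mono fun v hv => (Set.ext_iff.1 h v).2 hv

theorem nonempty [Finite α] (h : DefMem P S) : S.Nonempty := by
  obtain ⟨φ, hφ, rfl⟩ := h
  exact exists_realize_of_formulaMem hφ

theorem mono [Finite α] (h : DefMem P S) (hS' : A.Definable L S') (hSS' : S ⊆ S') :
    DefMem P S' := by
  obtain ⟨φ, hφ, rfl⟩ := h
  obtain ⟨ψ, rfl⟩ := hS'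
  exact ⟨ψ, hφ.mono fun v hv => hSS' hv, rfl⟩

theorem inter (h : DefMem P S) (h' : DefMem P S') : DefMem P (S ∩ S') := by
  obtain ⟨φ, hφ, rfl⟩ := h
  obtain ⟨ψ, hψ, rfl⟩ := h'
  exact ⟨φ ⊓ ψ, formulaMem_inf.2 ⟨hφ, hψ⟩, by ext v; simp⟩

theorem compl_iff [Finite α] (hS : A.Definable L S) : DefMem P Sᶜ ↔ ¬ DefMem P S := by
  obtain ⟨φ, rfl⟩ := hS
  have : (Set.ofPred φ.Realize : Set (α → 𝕄))ᶜ = {v | φ.not.Realize v} := by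
    ext v; simp
  rw [this, formulaMem_iff, formulaMem_iff, formulaMem_not]

theorem univ [Finite α] : DefMem P Set.univ := by
  by_contra h
  have := ((compl_iff (P := P) Set.definable_univ).2 h).nonempty
  simp at this

end DefMem

theorem realizes_iff [Finite α] {P : TypeOver L 𝕄 A α} {a : α → 𝕄} :
    Realizes a P ↔ ∀ S, DefMem P S → a ∈ S := by
  constructor
  · rintro rfl S ⟨φ, hφ, rfl⟩
    exact Theory.CompleteType.formula_mem_typeOf.1 hφ
  · intro h
    refine SetLike.ext fun ψ => ?_
    obtain ⟨φ, rfl⟩ := Formula.equivSentence.surjective ψ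
    rw [Theory.CompleteType.formula_mem_typeOf]
    constructor
    · intro hφ
      by_contra hn
      have := h _ ⟨φ.not, formulaMem_not.2 hn, rfl⟩
      exact this hφ
    · intro hφ
      exact h _ ⟨φ, hφ, rfl⟩

/-- The tuples `a` and `b` have the same type over `A`. -/
def SameType (L : FirstOrder.Language.{u, v}) [L.Structure 𝕄] (A : Set 𝕄) (a b : α → 𝕄) : Prop :=
  ∀ S : Set (α → 𝕄), A.Definable L S → (a ∈ S ↔ b ∈ S)

theorem typeOf_eq_iff_sameType {a b : α → 𝕄} :
    ((L[[A]]).completeTheory 𝕄).typeOf a = ((L[[A]]).completeTheory 𝕄).typeOf b ↔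
      SameType L A a b := by
  constructor
  · rintro h S ⟨φ, rfl⟩
    have := SetLike.ext_iff.1 h (Formula.equivSentence φ)
    rwa [Theory.CompleteType.formula_mem_typeOf, Theory.CompleteType.formula_mem_typeOf] at this
  · intro h
    refine SetLike.ext fun ψ => ?_
    obtain ⟨φ, rfl⟩ := Formula.equivSentence.surjective ψ
    rw [Theory.CompleteType.formula_mem_typeOf, Theory.CompleteType.formula_mem_typeOf]
    exact h _ ⟨φ, rfl⟩

/-- The two ways of adding constants are compared by truth in a model realizing `p`, which avoids a
syntactic comparison of language maps. -/
theorem formulaMem_restrict {p : GlobalType L 𝕄 α} {φ : (L[[A]]).Formula α} :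
    FormulaMem φ (restrict p A) ↔ FormulaMem ((toGlobal L A).onFormula φ) p := by
  obtain ⟨N, v, hv⟩ := Theory.exists_modelType_is_realized_in _ p
  let _ : (L[[A]]).Structure N := (toGlobal L A).reduct N
  let _ : (constantsOn α).Structure N := constantsOn.structure v
  have h₁ : FormulaMem φ (restrict p A) ↔
      ((toGlobal L A).addConstants α).onSentence (Formula.equivSentence φ) ∈ p := Iff.rfl
  have h₂ : ∀ ψ, ψ ∈ p ↔ ψ.Realize N := by
    intro ψ
    rw [← hv]
    exact mem_completeTheory
  rw [h₁, h₂, LHom.realize_onSentence, Formula.realize_equivSentence, FormulaMem, h₂,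
    Formula.realize_equivSentence, LHom.realize_onFormula]
  rfl

theorem realize_toGlobal {φ : (L[[A]]).Formula α} {v : α → 𝕄} :
    ((toGlobal L A).onFormula φ).Realize v ↔ φ.Realize v :=
  LHom.realize_onFormula _ _

theorem defMem_restrict [Finite α] {p : GlobalType L 𝕄 α} {S : Set (α → 𝕄)} :
    DefMem (restrict p A) S ↔ A.Definable L S ∧ DefMem p S := by
  constructor
  · rintro ⟨φ, hφ, rfl⟩
    refine ⟨⟨φ, rfl⟩, _, formulaMem_restrict.1 hφ, ?_⟩
    ext v
    exact realize_toGlobal.symm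
  · rintro ⟨⟨φ, rfl⟩, h⟩
    refine ⟨φ, formulaMem_restrict.2 (DefMem.formulaMem_iff.1 ?_), rfl⟩
    convert! h using 1
    ext v
    exact realize_toGlobal

theorem realizes_restrict_iff [Finite α] {p : GlobalType L 𝕄 α} {a : α → 𝕄} :
    Realizes a (restrict p A) ↔ ∀ S, A.Definable L S → DefMem p S → a ∈ S := by
  simp only [realizes_iff, defMem_restrict, and_imp]

end Bridge

/-! ### Weak orthogonality in terms of definable sets -/

section WeakOrthogonality

variable {L : FirstOrder.Language.{u, v}} {𝕄 : Type w} [L.Structure 𝕄] [Nonempty 𝕄]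
  {A : Set 𝕄} {α : Type w₁} {β : Type w₂}

theorem realize_instanceAt {k : ℕ} {φ : (L[[A]]).Formula (α ⊕ Fin k)} {b : Fin k → 𝕄}
    {a : α → 𝕄} : (instanceAt φ b).Realize a ↔ φ.Realize (Sum.elim a b) := by
  unfold instanceAt
  rw [Formula.Realize, BoundedFormula.realize_subst, ← Formula.Realize, LHom.realize_onFormula]
  refine iff_of_eq (congrArg _ ?_)
  ext (i | j)
  · rfl
  · simp

theorem IsInvariant.defMem_iff [Finite α] [Finite β] {p : GlobalType L 𝕄 α} (hp : IsInvariant A p)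
    {R : Set (α ⊕ β → 𝕄)} (hR : A.Definable L R) {b₁ b₂ : β → 𝕄} (hb : SameType L A b₁ b₂) :
    DefMem p {x | Sum.elim x b₁ ∈ R} ↔ DefMem p {x | Sum.elim x b₂ ∈ R} := by
  obtain ⟨k, ⟨e⟩⟩ := Finite.exists_equiv_fin β
  have hb' : SameType L A (b₁ ∘ e.symm) (b₂ ∘ e.symm) :=
    fun S hS => hb _ (hS.preimage_comp e.symm)
  have hR' := hR.preimage_comp (Sum.map id e : α ⊕ β → α ⊕ Fin k)
  obtain ⟨φ, hφ⟩ := hR'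
  have key := hp k _ _ (typeOf_eq_iff_sameType.2 hb') φ
  have hmem : ∀ (b : β → 𝕄) (x : α → 𝕄),
      Sum.elim x b ∈ R ↔ (instanceAt φ (b ∘ e.symm)).Realize x := by
    intro b x
    rw [realize_instanceAt]
    have := Set.ext_iff.1 hφ (Sum.elim x (b ∘ e.symm))
    rw [Set.mem_preimage] at this
    refine Iff.trans (iff_of_eq (congrArg (· ∈ R) ?_)) this
    ext (i | j) <;> simp
  simp only [hmem]
  rw [DefMem.formulaMem_iff, DefMem.formulaMem_iff]
  constructor
  · intro h
    refine (formulaMem_inf.2 ⟨key, h⟩).mono fun v hv => ?_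
    rw [Formula.realize_inf] at hv
    exact (Formula.realize_iff.1 hv.1).1 hv.2
  · intro h
    refine (formulaMem_inf.2 ⟨key, h⟩).mono fun v hv => ?_
    rw [Formula.realize_inf] at hv
    exact (Formula.realize_iff.1 hv.1).2 hv.2

theorem realize_lhomWithConstantsMap_equivSentence {L' : FirstOrder.Language} {γ : Type*}
    (f : α → γ) (σ : L'.Formula α) {N : Type*} [L'.Structure N] (v : γ → N) :
    (Formula.equivSentence.symm ((L'.lhomWithConstantsMap f).onSentence
      (Formula.equivSentence σ))).Realize v ↔ σ.Realize (v ∘ f) := by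
  rw [Formula.realize_equivSentence_symm]
  have h := Formula.realize_equivSentence_symm N (Formula.equivSentence σ) (v ∘ f)
  rw [Equiv.symm_apply_apply] at h
  rw [h]
  let s₁ : (constantsOn α).Structure N := constantsOn.structure (v ∘ f)
  let s₂ : (constantsOn γ).Structure N := constantsOn.structure v
  have : (LHom.constantsOnMap f).IsExpansionOn N := constantsOnMap_isExpansionOn rfl
  have : (L'.lhomWithConstantsMap f).IsExpansionOn N :=
    LHom.sumMap_isExpansionOn _ _ _
  exact LHom.realize_onSentence N _ _

theorem lhomWithConstantsMap_onSentence_lhomWithConstants {L' : FirstOrder.Language} {γ : Type*}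
    (f : α → γ) (ψ : L'.Sentence) :
    (L'.lhomWithConstantsMap f).onSentence ((L'.lhomWithConstants α).onSentence ψ) =
      (L'.lhomWithConstants γ).onSentence ψ := by
  have h := congrArg (fun g => LHom.onBoundedFormula g ψ)
    (LHom.map_constants_comp_sumInl (L := L') (f := f))
  exact (congrFun (LHom.comp_onBoundedFormula (L'.lhomWithConstantsMap f)
    (L'.lhomWithConstants α)) ψ).symm.trans h

/-- The set of formulas `P(x) ∪ Q(y)`. -/
abbrev unionTheory (P : TypeOver L 𝕄 A α) (Q : TypeOver L 𝕄 A β) : ((L[[A]])[[α ⊕ β]]).Theory :=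
  ((L[[A]]).lhomWithConstantsMap (Sum.inl : α → α ⊕ β)).onTheory (P : (L[[A]])[[α]].Theory) ∪
    ((L[[A]]).lhomWithConstantsMap (Sum.inr : β → α ⊕ β)).onTheory (Q : (L[[A]])[[β]].Theory)

/-- Compactness: the finitely many formulas used from each type are absorbed into one set S and one
set S', and a point of S × S' in `φ` satisfies them all in `𝕄`. -/
theorem isSatisfiable_unionTheory [Finite α] [Finite β] {P : TypeOver L 𝕄 A α}
    {Q : TypeOver L 𝕄 A β} {φ : (L[[A]]).Formula (α ⊕ β)}
    (h : ∀ S S', DefMem P S → DefMem Q S' → ∃ x ∈ S, ∃ y ∈ S', φ.Realize (Sum.elim x y)) :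
    (unionTheory P Q ∪ {Formula.equivSentence φ}).IsSatisfiable := by
  classical
  rw [Theory.isSatisfiable_iff_isFinitelySatisfiable]
  intro T₀ hT₀
  have key : ∃ S S', DefMem P S ∧ DefMem Q S' ∧ ∀ x ∈ S, ∀ y ∈ S', φ.Realize (Sum.elim x y) →
      ∀ ψ ∈ T₀, (Formula.equivSentence.symm ψ).Realize (Sum.elim x y) := by
    induction T₀ using Finset.induction_on with
    | empty => exact ⟨_, _, DefMem.univ, DefMem.univ, by simp⟩
    | insert ψ T₀ _ ih =>
      rw [Finset.coe_insert, Set.insert_subset_iff] at hT₀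
      obtain ⟨S, S', hS, hS', hSS'⟩ := ih hT₀.2
      obtain (⟨χ, hχ, rfl⟩ | ⟨χ, hχ, rfl⟩) | hψ := hT₀.1
      · obtain ⟨σ, rfl⟩ := Formula.equivSentence.surjective χ
        refine ⟨S ∩ {v | σ.Realize v}, S', hS.inter ⟨σ, hχ, rfl⟩, hS', fun x hx y hy hxy => ?_⟩
        refine Finset.forall_mem_insert _ _ _ |>.2 ⟨?_, hSS' x hx.1 y hy hxy⟩
        exact (realize_lhomWithConstantsMap_equivSentence _ σ _).2 hx.2
      · obtain ⟨σ, rfl⟩ := Formula.equivSentence.surjective χ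
        refine ⟨S, S' ∩ {v | σ.Realize v}, hS, hS'.inter ⟨σ, hχ, rfl⟩, fun x hx y hy hxy => ?_⟩
        refine Finset.forall_mem_insert _ _ _ |>.2 ⟨?_, hSS' x hx y hy.1 hxy⟩
        exact (realize_lhomWithConstantsMap_equivSentence _ σ _).2 hy.2
      · rw [Set.mem_singleton_iff] at hψ
        subst hψ
        refine ⟨S, S', hS, hS', fun x hx y hy hxy => ?_⟩
        refine Finset.forall_mem_insert _ _ _ |>.2 ⟨?_, hSS' x hx y hy hxy⟩
        rwa [Equiv.symm_apply_apply]
  obtain ⟨S, S', hS, hS', hSS'⟩ := key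
  obtain ⟨x, hx, y, hy, hxy⟩ := h S S' hS hS'
  let _ : (constantsOn (α ⊕ β)).Structure 𝕄 := constantsOn.structure (Sum.elim x y)
  have : 𝕄 ⊨ (T₀ : ((L[[A]])[[α ⊕ β]]).Theory) := ⟨fun ψ hψ =>
    (Formula.realize_equivSentence_symm _ _ _).1 (hSS' x hx y hy hxy ψ hψ)⟩
  exact Theory.Model.isSatisfiable 𝕄

/-- A consistent set extends to a complete type, realized in some model of the theory; solvability
of the conjunction then passes back to `𝕄`. -/
theorem not_isSatisfiable_unionTheory [Finite α] [Finite β] {P : TypeOver L 𝕄 A α}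
    {Q : TypeOver L 𝕄 A β} {φ : (L[[A]]).Formula (α ⊕ β)} {S : Set (α → 𝕄)} {S' : Set (β → 𝕄)}
    (hS : DefMem P S) (hS' : DefMem Q S')
    (h : ∀ x ∈ S, ∀ y ∈ S', ¬ φ.Realize (Sum.elim x y)) :
    ¬ (unionTheory P Q ∪ {Formula.equivSentence φ}).IsSatisfiable := by
  intro hsat
  obtain ⟨σ, hσ, rfl⟩ := hS
  obtain ⟨τ, hτ, rfl⟩ := hS'
  have hsub : ((L[[A]]).lhomWithConstants (α ⊕ β)).onTheory ((L[[A]]).completeTheory 𝕄) ⊆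
      unionTheory P Q := by
    rintro _ ⟨ψ, hψ, rfl⟩
    exact Or.inl ⟨_, P.subset ⟨ψ, hψ, rfl⟩,
      lhomWithConstantsMap_onSentence_lhomWithConstants _ ψ⟩
  have hne := mt (Theory.CompleteType.setOfPred_subset_eq_empty_iff
    (T := (L[[A]]).completeTheory 𝕄) (unionTheory P Q ∪ {Formula.equivSentence φ})).1
    (not_not.2 (by
      rwa [Set.union_eq_self_of_subset_left (hsub.trans Set.subset_union_left)]))
  obtain ⟨r, hr⟩ := Set.nonempty_iff_ne_empty.2 hne
  obtain ⟨N, v, rfl⟩ := Theory.exists_modelType_is_realized_in _ r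
  have hσ' := hr (Or.inl (Or.inl ⟨_, hσ, rfl⟩))
  have hτ' := hr (Or.inl (Or.inr ⟨_, hτ, rfl⟩))
  have hφ' := hr (Or.inr rfl)
  rw [SetLike.mem_coe, Theory.CompleteType.mem_typeOf] at hσ' hτ' hφ'
  replace hσ' := (realize_lhomWithConstantsMap_equivSentence _ σ _).1 hσ'
  replace hτ' := (realize_lhomWithConstantsMap_equivSentence _ τ _).1 hτ'
  rw [Equiv.symm_apply_apply] at hφ'
  obtain ⟨a, ha⟩ := exists_realize_of_mem_model (𝕄 := 𝕄)
    (φ := (σ.relabel (Sum.inl : α → α ⊕ β) ⊓ τ.relabel (Sum.inr : β → α ⊕ β)) ⊓ φ) N v (by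
      simpa [Formula.realize_inf, Formula.realize_relabel] using ⟨⟨hσ', hτ'⟩, hφ'⟩)
  simp only [Formula.realize_inf, Formula.realize_relabel] at ha
  refine h _ ha.1.1 _ ha.1.2 ?_
  rw [Sum.elim_comp_inl_inr]
  exact ha.2

theorem weaklyOrthogonal_iff [Finite α] [Finite β] {P : TypeOver L 𝕄 A α}
    {Q : TypeOver L 𝕄 A β} : WeaklyOrthogonal P Q ↔ ∀ R : Set (α ⊕ β → 𝕄), A.Definable L R →
      ∃ S S', DefMem P S ∧ DefMem Q S' ∧
        ((∀ x ∈ S, ∀ y ∈ S', Sum.elim x y ∈ R) ∨ ∀ x ∈ S, ∀ y ∈ S', Sum.elim x y ∉ R) := by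
  constructor
  · rintro ⟨-, hc⟩ R ⟨φ, rfl⟩
    by_contra! hn
    obtain h | h := hc (Formula.equivSentence φ)
    · rw [Theory.models_iff_not_satisfiable, ← Formula.equivSentence_not] at h
      refine h (isSatisfiable_unionTheory fun S S' hS hS' => ?_)
      exact (hn S S' hS hS').1
    · rw [Theory.models_iff_not_satisfiable, ← Formula.equivSentence_not,
        ← Formula.equivSentence_not] at h
      refine h (isSatisfiable_unionTheory fun S S' hS hS' => ?_)
      obtain ⟨x, hx, y, hy, hxy⟩ := (hn S S' hS hS').2
      exact ⟨x, hx, y, hy, by simpa [Formula.realize_not] using hxy⟩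
  · intro h
    refine ⟨?_, fun ψ => ?_⟩
    · refine (isSatisfiable_unionTheory (P := P) (Q := Q) (φ := ⊤) ?_).mono Set.subset_union_left
      intro S S' hS hS'
      obtain ⟨x, hx⟩ := hS.nonempty
      obtain ⟨y, hy⟩ := hS'.nonempty
      exact ⟨x, hx, y, hy, by simp⟩
    · obtain ⟨φ, rfl⟩ := Formula.equivSentence.surjective ψ
      obtain ⟨S, S', hS, hS', hR | hR⟩ := h {v | φ.Realize v} ⟨φ, rfl⟩
      · left
        rw [Theory.models_iff_not_satisfiable, ← Formula.equivSentence_not]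
        refine not_isSatisfiable_unionTheory hS hS' fun x hx y hy => ?_
        rw [Formula.realize_not, not_not]
        exact hR x hx y hy
      · right
        rw [Theory.models_iff_not_satisfiable, ← Formula.equivSentence_not,
          ← Formula.equivSentence_not]
        refine not_isSatisfiable_unionTheory hS hS' fun x hx y hy => ?_
        rw [Formula.realize_not, Formula.realize_not, not_not]
        exact hR x hx y hy

end WeakOrthogonality

/-! ### Saturation and its consequences for definable sets -/

section Saturation

variable {L : FirstOrder.Language.{u, v}} {𝕄 : Type w} [L.Structure 𝕄] [Nonempty 𝕄]
  {A B : Set 𝕄} {α : Type w₁} {β : Type w₂}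

/-- A fiber of a definable set is definable over the added parameters. -/
theorem definable_fiber {R : Set (α ⊕ β → 𝕄)} (hR : A.Definable L R) (b : β → 𝕄)
    (hAB : A ⊆ B) (hb : Set.range b ⊆ B) : B.Definable L {x : α → 𝕄 | Sum.elim x b ∈ R} := by
  rw [Set.definable_iff_exists_formula_sum] at hR ⊢
  obtain ⟨φ, rfl⟩ := hR
  refine ⟨φ.relabel (Sum.elim (fun a => Sum.inl (Set.inclusion hAB a))
    (Sum.elim Sum.inr fun j => Sum.inl ⟨b j, hb ⟨j, rfl⟩⟩)), ?_⟩
  ext x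
  simp only [Set.mem_ofPred_eq, Formula.realize_relabel]
  refine iff_of_eq (congrArg _ ?_)
  ext (a | i | j) <;> rfl

/-- A definable set is a fiber of a set that is definable without parameters. -/
theorem exists_eq_fiber {S : Set (α → 𝕄)} (hS : A.Definable L S) :
    ∃ (k : ℕ) (c : Fin k → 𝕄) (R : Set (α ⊕ Fin k → 𝕄)), Set.range c ⊆ A ∧
      (∅ : Set 𝕄).Definable L R ∧ S = {x | Sum.elim x c ∈ R} := by
  obtain ⟨A₀, hA₀, hS₀⟩ := Set.definable_iff_finitely_definable.1 hS
  obtain ⟨φ, rfl⟩ := Set.definable_iff_exists_formula_sum.1 hS₀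
  obtain ⟨k, ⟨e⟩⟩ := Finite.exists_equiv_fin (A₀ : Set 𝕄)
  refine ⟨k, fun j => e.symm j, {v | (φ.relabel (Sum.elim (fun a => Sum.inr (e a))
    Sum.inl)).Realize v}, ?_, Set.empty_definable_iff.2 ⟨_, rfl⟩, ?_⟩
  · rintro _ ⟨j, rfl⟩
    exact hA₀ (e.symm j).2
  · ext x
    simp only [Set.mem_ofPred_eq, Formula.realize_relabel]
    refine iff_of_eq (congrArg _ ?_)
    ext (a | i) <;> simp

/-- A nonempty set definable over an elementary substructure has a point there. -/
theorem exists_mem_elementarySubstructure [Finite α] (M : L.ElementarySubstructure 𝕄)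
    {S : Set (α → 𝕄)} (hS : (M : Set 𝕄).Definable L S) (hne : S.Nonempty) :
    ∃ c ∈ S, ∀ i, c i ∈ M := by
  obtain ⟨φ, rfl⟩ := Set.definable_iff_exists_formula_sum.1 hS
  obtain ⟨c, hc⟩ := hne
  have h : (φ.iExs α).Realize (fun a : M => (a : 𝕄)) :=
    Formula.realize_iExs.2 ⟨c, hc⟩
  have h' : (φ.iExs α).Realize (fun a : M => a) :=
    (M.subtype.map_formula (φ.iExs α) (fun a : M => a)).1 h
  obtain ⟨c', hc'⟩ := Formula.realize_iExs.1 h'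
  refine ⟨fun i => c' i, ?_, fun i => (c' i).2⟩
  have := (M.subtype.map_formula φ _).2 hc'
  change φ.Realize _
  refine (iff_of_eq (congrArg _ ?_)).1 this
  ext (a | i) <;> rfl

variable {κ : Cardinal.{w}}

theorem exists_mem_directed_fin_one (h𝕄 : IsMonster L 𝕄 κ) (hB : #B < κ)
    {F : Set (Set (Fin 1 → 𝕄))} (hF : F.Nonempty) (hdef : ∀ S ∈ F, B.Definable L S)
    (hdir : ∀ S ∈ F, ∀ S' ∈ F, ∃ U ∈ F, U ⊆ S ∩ S') (hne : ∀ S ∈ F, S.Nonempty) :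
    ∃ c, ∀ S ∈ F, c ∈ S := by
  classical
  let Φ : ((L[[B]])[[Fin 1]]).Theory :=
    {ψ | {v | (Formula.equivSentence.symm ψ).Realize v} ∈ F}
  have hsat : (((L[[B]]).lhomWithConstants (Fin 1)).onTheory ((L[[B]]).completeTheory 𝕄) ∪
      Φ).IsSatisfiable := by
    rw [Theory.isSatisfiable_iff_isFinitelySatisfiable]
    intro T₀ hT₀
    have key : ∃ U ∈ F, ∀ x ∈ U, ∀ ψ ∈ T₀, (Formula.equivSentence.symm ψ).Realize x := by
      induction T₀ using Finset.induction_on with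
      | empty => exact ⟨_, hF.some_mem, by simp⟩
      | insert ψ T₀ _ ih =>
        rw [Finset.coe_insert, Set.insert_subset_iff] at hT₀
        obtain ⟨U, hU, hUT⟩ := ih hT₀.2
        obtain hψ | hψ := hT₀.1
        · refine ⟨U, hU, fun x hx => (Finset.forall_mem_insert _ _ _).2 ⟨?_, hUT x hx⟩⟩
          exact Theory.CompleteType.mem_typeOf.1
            ((((L[[B]]).completeTheory 𝕄).typeOf x).subset hψ)
        · obtain ⟨V, hV, hVU⟩ := hdir U hU _ hψ
          exact ⟨V, hV, fun x hx => (Finset.forall_mem_insert _ _ _).2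
            ⟨(hVU hx).2, hUT x (hVU hx).1⟩⟩
    obtain ⟨U, hU, hUT⟩ := key
    obtain ⟨x, hx⟩ := hne U hU
    let _ : (constantsOn (Fin 1)).Structure 𝕄 := constantsOn.structure x
    have : 𝕄 ⊨ (T₀ : ((L[[B]])[[Fin 1]]).Theory) := ⟨fun ψ hψ =>
      (Formula.realize_equivSentence_symm _ _ _).1 (hUT x hx ψ hψ)⟩
    exact Theory.Model.isSatisfiable 𝕄
  obtain ⟨P, hP⟩ := Set.nonempty_iff_ne_empty.2
    (mt (Theory.CompleteType.setOfPred_subset_eq_empty_iff _).1 (not_not.2 hsat))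
  obtain ⟨c, rfl⟩ := h𝕄.saturated B hB P
  refine ⟨c, fun S hS => ?_⟩
  obtain ⟨φ, rfl⟩ := hdef S hS
  refine Theory.CompleteType.formula_mem_typeOf.1 (hP ?_)
  change {v | (Formula.equivSentence.symm (Formula.equivSentence φ)).Realize v} ∈ F
  rwa [Equiv.symm_apply_apply]

theorem mk_union_lt (h𝕄 : IsMonster L 𝕄 κ) (hA : #A < κ) (hB : #B < κ) :
    #(A ∪ B : Set 𝕄) < κ :=
  (mk_union_le A B).trans_lt (add_lt_of_lt h𝕄.aleph0_lt.le hA hB)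

theorem mk_lt_of_countable (h𝕄 : IsMonster L 𝕄 κ) (hA : A.Countable) : #A < κ :=
  hA.le_aleph0.trans_lt h𝕄.aleph0_lt

/-- Saturation: a directed family of nonempty sets definable over a small set has a common
point. -/
theorem exists_mem_directed (h𝕄 : IsMonster L 𝕄 κ) {k : ℕ} (hB : #B < κ)
    {F : Set (Set (Fin k → 𝕄))} (hF : F.Nonempty) (hdef : ∀ S ∈ F, B.Definable L S)
    (hdir : ∀ S ∈ F, ∀ S' ∈ F, ∃ U ∈ F, U ⊆ S ∩ S') (hne : ∀ S ∈ F, S.Nonempty) :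
    ∃ c, ∀ S ∈ F, c ∈ S := by
  induction k generalizing B with
  | zero =>
    refine ⟨Fin.elim0, fun S hS => ?_⟩
    obtain ⟨x, hx⟩ := hne S hS
    rwa [Subsingleton.elim Fin.elim0 x]
  | succ k ih =>
    -- Forgetting the last coordinate keeps the family directed, definable and nonempty. The last
    -- coordinate is found afterwards, by saturation in one variable over the still small set B c.
    obtain ⟨c, hc⟩ := ih hB (F := (fun S => (fun g => g ∘ Fin.castSucc) '' S) '' F)
      (hF.image _) (by
        rintro _ ⟨S, hS, rfl⟩
        exact (hdef S hS).image_comp _) (by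
        rintro _ ⟨S, hS, rfl⟩ _ ⟨S', hS', rfl⟩
        obtain ⟨U, hU, hUS⟩ := hdir S hS S' hS'
        exact ⟨_, ⟨U, hU, rfl⟩, Set.subset_inter
          (Set.image_mono (hUS.trans Set.inter_subset_left))
          (Set.image_mono (hUS.trans Set.inter_subset_right))⟩) (by
        rintro _ ⟨S, hS, rfl⟩
        exact (hne S hS).image _)
    let e : Fin (k + 1) → Fin 1 ⊕ Fin k := Fin.lastCases (Sum.inl 0) Sum.inr
    let G : Set (Fin (k + 1) → 𝕄) → Set (Fin 1 → 𝕄) :=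
      fun S => {t | Sum.elim t c ∈ (fun g : Fin 1 ⊕ Fin k → 𝕄 => g ∘ e) ⁻¹' S}
    have hGm : ∀ S t, t ∈ G S ↔ Fin.snoc (α := fun _ => 𝕄) c (t 0) ∈ S := by
      intro S t
      refine iff_of_eq (congrArg (· ∈ S) ?_)
      ext i
      refine Fin.lastCases ?_ (fun i => ?_) i <;> simp [e]
    obtain ⟨t, ht⟩ := exists_mem_directed_fin_one h𝕄
      (mk_union_lt h𝕄 hB (mk_lt_of_countable h𝕄 (Set.countable_range c))) (F := G '' F)
      (hF.image _) (by
        rintro _ ⟨S, hS, rfl⟩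
        exact definable_fiber ((hdef S hS).preimage_comp e) c Set.subset_union_left
          Set.subset_union_right) (by
        rintro _ ⟨S, hS, rfl⟩ _ ⟨S', hS', rfl⟩
        obtain ⟨U, hU, hUS⟩ := hdir S hS S' hS'
        exact ⟨_, ⟨U, hU, rfl⟩, fun t ht => ⟨(hUS ht).1, (hUS ht).2⟩⟩) (by
        rintro _ ⟨S, hS, rfl⟩
        obtain ⟨x, hx, hxc⟩ := hc _ ⟨S, hS, rfl⟩
        refine ⟨fun _ => x (Fin.last k), (hGm S _).2 ?_⟩
        convert! hx using 1
        ext i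
        refine Fin.lastCases ?_ (fun i => ?_) i
        · simp
        · simpa using (congrFun hxc i).symm)
    exact ⟨_, fun S hS => (hGm S t).1 (ht _ ⟨S, hS, rfl⟩)⟩

/-- The restriction of a global type to a small set is realized, together with any set that meets
all of its formulas. -/
theorem exists_realizes_restrict_inter (h𝕄 : IsMonster L 𝕄 κ) {k : ℕ} (hB : #B < κ)
    (p : GlobalType L 𝕄 (Fin k)) {S : Set (Fin k → 𝕄)} (hS : A.Definable L S) (hA : #A < κ)
    (h : ∀ U, B.Definable L U → DefMem p U → (U ∩ S).Nonempty) :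
    ∃ a ∈ S, Realizes a (restrict p B) := by
  obtain ⟨a, ha⟩ := exists_mem_directed h𝕄 (mk_union_lt h𝕄 hB hA)
    (F := (· ∩ S) '' {U | B.Definable L U ∧ DefMem p U})
    (Set.Nonempty.image _ ⟨Set.univ, Set.definable_univ, DefMem.univ⟩) (by
      rintro _ ⟨U, hU, rfl⟩
      exact (hU.1.mono Set.subset_union_left).inter (hS.mono Set.subset_union_right)) (by
      rintro _ ⟨U, hU, rfl⟩ _ ⟨V, hV, rfl⟩
      exact ⟨_, ⟨U ∩ V, ⟨hU.1.inter hV.1, hU.2.inter hV.2⟩, rfl⟩,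
        fun x hx => ⟨⟨hx.1.1, hx.2⟩, ⟨hx.1.2, hx.2⟩⟩⟩) (by
      rintro _ ⟨U, hU, rfl⟩
      exact h U hU.1 hU.2)
  refine ⟨a, (ha _ ⟨Set.univ, ⟨Set.definable_univ, DefMem.univ⟩, rfl⟩).2, ?_⟩
  exact realizes_restrict_iff.2 fun U hU hpU => (ha _ ⟨U, ⟨hU, hpU⟩, rfl⟩).1

theorem exists_realizes_restrict (h𝕄 : IsMonster L 𝕄 κ) {k : ℕ} (hB : #B < κ)
    (p : GlobalType L 𝕄 (Fin k)) : ∃ a, Realizes a (restrict p B) := by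
  obtain ⟨a, -, ha⟩ := exists_realizes_restrict_inter h𝕄 hB p
    (Set.definable_univ (A := (∅ : Set 𝕄))) (mk_lt_of_countable h𝕄 Set.countable_empty)
    fun U _ hU => by simpa using hU.nonempty
  exact ⟨a, ha⟩

/-- A set definable over a small set and invariant over a small set `A` is definable over `A`. -/
theorem definable_of_invariant (h𝕄 : IsMonster L 𝕄 κ) {k : ℕ} (hA : #A < κ) (hB : #B < κ)
    {D : Set (Fin k → 𝕄)} (hD : B.Definable L D)
    (hinv : ∀ c c', SameType L A c c' → c ∈ D → c' ∈ D) : A.Definable L D := by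
  have hAB := mk_union_lt h𝕄 hA hB
  have hD' : (A ∪ B).Definable L D := hD.mono Set.subset_union_right
  -- If no `A`-definable neighborhood of c lay inside D, saturation would give a point outside D
  -- with the same type over `A` as c.
  have local_def : ∀ c ∈ D, ∃ U, A.Definable L U ∧ c ∈ U ∧ U ⊆ D := by
    intro c hc
    by_contra! hn
    obtain ⟨c', hc'⟩ := exists_mem_directed h𝕄 hAB
      (F := (· ∩ Dᶜ) '' {U | A.Definable L U ∧ c ∈ U})
      (Set.Nonempty.image _ ⟨Set.univ, Set.definable_univ, trivial⟩) (by
        rintro _ ⟨U, hU, rfl⟩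
        exact (hU.1.mono Set.subset_union_left).inter hD'.compl) (by
        rintro _ ⟨U, hU, rfl⟩ _ ⟨V, hV, rfl⟩
        exact ⟨_, ⟨U ∩ V, ⟨hU.1.inter hV.1, hU.2, hV.2⟩, rfl⟩,
          fun x hx => ⟨⟨hx.1.1, hx.2⟩, ⟨hx.1.2, hx.2⟩⟩⟩) (by
        rintro _ ⟨U, hU, rfl⟩
        obtain ⟨x, hx, hxD⟩ := Set.not_subset.1 (hn U hU.1 hU.2)
        exact ⟨x, hx, hxD⟩)
    refine (hc' _ ⟨Set.univ, ⟨Set.definable_univ, trivial⟩, rfl⟩).2 (hinv c c' ?_ hc)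
    intro S hS
    refine ⟨fun h => (hc' _ ⟨S, ⟨hS, h⟩, rfl⟩).1, fun h => ?_⟩
    by_contra h'
    exact (hc' _ ⟨Sᶜ, ⟨hS.compl, h'⟩, rfl⟩).1 h
  -- The `A`-definable subsets of D are closed under union. If none of them were D, saturation would
  -- give a point of D outside all of them, against `local_def`.
  by_contra hn
  obtain ⟨c, hc⟩ := exists_mem_directed h𝕄 hAB
    (F := (D \ ·) '' {U | A.Definable L U ∧ U ⊆ D})
    (Set.Nonempty.image _ ⟨∅, Set.definable_empty, Set.empty_subset _⟩) (by
      rintro _ ⟨U, hU, rfl⟩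
      exact hD'.sdiff (hU.1.mono Set.subset_union_left)) (by
      rintro _ ⟨U, hU, rfl⟩ _ ⟨V, hV, rfl⟩
      exact ⟨_, ⟨U ∪ V, ⟨hU.1.union hV.1, Set.union_subset hU.2 hV.2⟩, rfl⟩,
        fun x hx => ⟨⟨hx.1, fun h => hx.2 (Or.inl h)⟩, ⟨hx.1, fun h => hx.2 (Or.inr h)⟩⟩⟩) (by
      rintro _ ⟨U, hU, rfl⟩
      by_contra he
      rw [Set.not_nonempty_iff_eq_empty, Set.sdiff_eq_empty] at he
      exact hn (he.antisymm hU.2 ▸ hU.1))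
  have hcD := (hc _ ⟨∅, ⟨Set.definable_empty, Set.empty_subset _⟩, rfl⟩).1
  obtain ⟨U, hU, hcU, hUD⟩ := local_def c hcD
  exact (hc _ ⟨U, ⟨hU, hUD⟩, rfl⟩).2 hcU

end Saturation

/-! ### Morley sequences -/

section Morley

variable {L : FirstOrder.Language.{u, v}} {𝕄 : Type w} [L.Structure 𝕄] [Nonempty 𝕄]
  {A B : Set 𝕄} {α : Type w₁} {β : Type w₂}

theorem Realizes.mono_set [Finite α] {p : GlobalType L 𝕄 α} {a : α → 𝕄}
    (h : Realizes a (restrict p B)) (hAB : A ⊆ B) : Realizes a (restrict p A) :=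
  realizes_restrict_iff.2 fun S hS hpS => realizes_restrict_iff.1 h S (hS.mono hAB) hpS

theorem Realizes.mem_iff [Finite α] {p : GlobalType L 𝕄 α} {a : α → 𝕄}
    (h : Realizes a (restrict p A)) {S : Set (α → 𝕄)} (hS : A.Definable L S) :
    a ∈ S ↔ DefMem p S := by
  refine ⟨fun ha => ?_, realizes_restrict_iff.1 h S hS⟩
  by_contra hn
  exact realizes_restrict_iff.1 h _ hS.compl
    ((DefMem.compl_iff (hS.mono (Set.subset_univ A))).2 hn) ha

/-- The elements of the sequence `a` that occur before the index `i`. -/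
abbrev elementsBefore {ι : Type*} [LT ι] (a : ι → α → 𝕄) (i : ι) : Set 𝕄 :=
  {c | ∃ j, j < i ∧ c ∈ Set.range (a j)}

/-- Morley sequences indexed by an arbitrary order. -/
def IsMorleyOn {ι : Type*} [LT ι] (A : Set 𝕄) (p : GlobalType L 𝕄 α) (a : ι → α → 𝕄) : Prop :=
  ∀ i, Realizes (a i) (restrict p (A ∪ elementsBefore a i))

theorem IsMorleyOn.comp [Finite α] {ι ι' : Type*} [Preorder ι] [Preorder ι'] {p : GlobalType L 𝕄 α}
    {a : ι → α → 𝕄} (ha : IsMorleyOn A p a) {e : ι' → ι} (he : StrictMono e) :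
    IsMorleyOn A p (a ∘ e) := by
  intro i
  refine (ha (e i)).mono_set (Set.union_subset_union_right _ ?_)
  rintro c ⟨j, hj, hc⟩
  exact ⟨e j, he hj, hc⟩

theorem IsMorleyOn.mono_set [Finite α] {ι : Type*} [LT ι] {p : GlobalType L 𝕄 α}
    {a : ι → α → 𝕄} (ha : IsMorleyOn B p a) (hAB : A ⊆ B) : IsMorleyOn A p a :=
  fun i => (ha i).mono_set (Set.union_subset_union_left _ hAB)

/-- Finite Morley sequences of the same length have the same type. -/
theorem IsMorleyOn.sameType [Finite α] {p : GlobalType L 𝕄 α} (hp : IsInvariant A p) {n : ℕ}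
    {f g : Fin n → α → 𝕄} (hf : IsMorleyOn A p f) (hg : IsMorleyOn A p g) :
    SameType L A (Function.uncurry f) (Function.uncurry g) := by
  induction n with
  | zero =>
    intro S _
    rw [Subsingleton.elim (Function.uncurry f) (Function.uncurry g)]
  | succ n ih =>
    intro S hS
    let e : Fin (n + 1) × α → α ⊕ (Fin n × α) := fun ix =>
      Fin.lastCases (motive := fun _ => α ⊕ (Fin n × α)) (Sum.inl ix.2)
        (fun i => Sum.inr (i, ix.2)) ix.1
    have hR := hS.preimage_comp e
    -- The last tuple realizes `p` over the earlier ones, so membership in S depends only on those;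
    -- invariance and the induction hypothesis then compare f with g.
    have key : ∀ h : Fin (n + 1) → α → 𝕄, IsMorleyOn A p h → (Function.uncurry h ∈ S ↔
        DefMem p {x | Sum.elim x (Function.uncurry (h ∘ Fin.castSucc)) ∈
          (fun w : α ⊕ (Fin n × α) → 𝕄 => w ∘ e) ⁻¹' S}) := by
      intro h hh
      rw [← (hh (Fin.last n)).mem_iff (definable_fiber hR _ Set.subset_union_left ?_)]
      · refine iff_of_eq (congrArg (· ∈ S) ?_)
        ext ⟨i, x⟩
        refine Fin.lastCases ?_ (fun i => ?_) i <;> simp [e]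
      · rintro _ ⟨⟨i, x⟩, rfl⟩
        exact Or.inr ⟨i.castSucc, Fin.castSucc_lt_last i, x, rfl⟩
    rw [key f hf, key g hg]
    exact hp.defMem_iff hR
      (ih (hf.comp Fin.strictMono_castSucc) (hg.comp Fin.strictMono_castSucc))

theorem exists_wellFounded_choice {ι X : Type*} [LT ι] [WellFoundedLT ι]
    (P : ∀ i : ι, (∀ j, j < i → X) → X → Prop) (h : ∀ i g, ∃ x, P i g x) :
    ∃ f : ι → X, ∀ i, P i (fun j _ => f j) (f i) := by
  choose F hF using h
  let f : ι → X := (wellFounded_lt (α := ι)).fix fun i g => F i g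
  refine ⟨f, fun i => ?_⟩
  have : f i = F i fun j _ => f j := WellFounded.fix_eq _ _ _
  rw [this]
  exact hF i _

variable {κ : Cardinal.{w}} {m : ℕ}

theorem countable_elementsBefore {ι : Type*} [LT ι] [Countable ι] [Countable α]
    (a : ι → α → 𝕄) (i : ι) : (elementsBefore a i).Countable := by
  have : elementsBefore a i = ⋃ j : {j // j < i}, Set.range (a j) := by
    ext c
    simp [elementsBefore]
  rw [this]
  exact Set.countable_iUnion fun _ => Set.countable_range _

theorem exists_isMorleyOn (h𝕄 : IsMonster L 𝕄 κ) (hA : #A < κ) (p : GlobalType L 𝕄 (Fin m))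
    (ι : Type*) [LT ι] [WellFoundedLT ι] [Countable ι] :
    ∃ a : ι → Fin m → 𝕄, IsMorleyOn A p a := by
  refine exists_wellFounded_choice (X := Fin m → 𝕄) (fun i g x =>
    Realizes x (restrict p (A ∪ {c | ∃ j, ∃ hj : j < i, c ∈ Set.range (g j hj)}))) ?_ |>.imp
    fun a ha i => (ha i).mono_set (Set.union_subset_union_right _ ?_)
  · intro i g
    refine exists_realizes_restrict h𝕄 (mk_union_lt h𝕄 hA (mk_lt_of_countable h𝕄 ?_)) p
    have : {c | ∃ j, ∃ hj : j < i, c ∈ Set.range (g j hj)} =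
        ⋃ j : {j // j < i}, Set.range (g j.1 j.2) := by
      ext c
      simp
    rw [this]
    exact Set.countable_iUnion fun _ => Set.countable_range _
  · rintro c ⟨j, hj, hc⟩
    exact ⟨j, hj, hc⟩

/-- A finite Morley sequence over `A` extends to an infinite one whose new elements also realize
the type over `c`. -/
theorem exists_extend_isMorleyOn (h𝕄 : IsMonster L 𝕄 κ) (hA : #A < κ) {p : GlobalType L 𝕄 (Fin m)}
    {n k : ℕ} {f : Fin n → Fin m → 𝕄} (hf : IsMorleyOn A p f) (c : Fin k → 𝕄) :
    ∃ a : ℕ → Fin m → 𝕄, IsMorleyOn A p a ∧ (∀ i : Fin n, a i = f i) ∧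
      ∀ i, n ≤ i → Realizes (a i) (restrict p (A ∪ Set.range c)) := by
  obtain ⟨a, ha⟩ := exists_wellFounded_choice (ι := ℕ) (X := Fin m → 𝕄) (fun i g x =>
    (∀ hi : i < n, x = f ⟨i, hi⟩) ∧ (n ≤ i → Realizes x (restrict p ((A ∪ Set.range c) ∪
      {d | ∃ j, ∃ hj : j < i, d ∈ Set.range (g j hj)})))) (by
    intro i g
    obtain hi | hi := lt_or_ge i n
    · exact ⟨f ⟨i, hi⟩, fun _ => rfl, fun h => absurd h (not_le.2 hi)⟩
    · have hc : {d | ∃ j, ∃ hj : j < i, d ∈ Set.range (g j hj)} =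
          ⋃ j : {j // j < i}, Set.range (g j.1 j.2) := by
        ext d
        simp
      obtain ⟨x, hx⟩ := exists_realizes_restrict h𝕄 (B := (A ∪ Set.range c) ∪
        {d | ∃ j, ∃ hj : j < i, d ∈ Set.range (g j hj)}) (mk_union_lt h𝕄
        (mk_union_lt h𝕄 hA (mk_lt_of_countable h𝕄 (Set.countable_range c)))
        (mk_lt_of_countable h𝕄
          (hc ▸ Set.countable_iUnion fun _ => Set.countable_range _))) p
      exact ⟨x, fun h => absurd hi (not_le.2 h), fun _ => hx⟩)
  refine ⟨a, fun i => ?_, fun i => (ha i).1 i.2,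
    fun i hi => ((ha i).2 hi).mono_set Set.subset_union_left⟩
  obtain hi | hi := lt_or_ge i n
  · rw [(ha i).1 hi]
    refine (hf ⟨i, hi⟩).mono_set (Set.union_subset_union_right _ ?_)
    rintro d ⟨j, hj, hd⟩
    rw [(ha j).1 (hj.trans hi)] at hd
    exact ⟨⟨j, hj.trans hi⟩, hj, hd⟩
  · refine ((ha i).2 hi).mono_set (Set.union_subset_union Set.subset_union_left ?_)
    rintro d ⟨j, hj, hd⟩
    exact ⟨j, hj, hd⟩

instance countable_Iio_omega0_add_omega0 :
    Countable (Set.Iio (Ordinal.omega0.{w} + Ordinal.omega0.{w})) := by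
  rw [← Cardinal.mk_le_aleph0_iff, Cardinal.mk_Iio_ordinal]
  simp

/-- The data of generic stability that concern Morley sequences. -/
def MorleyFinCofin (A : Set 𝕄) (p : GlobalType L 𝕄 α) : Prop :=
  ∀ o : Ordinal.{w}, Ordinal.omega0 ≤ o → ∀ a : Set.Iio o → α → 𝕄, IsMorleySequence A p a →
    ∀ φ : GlobalFormula L 𝕄 α, {i | φ.Realize (a i)}.Finite ∨ {i | ¬ φ.Realize (a i)}.Finite

/-- A uniform, finite form of generic stability. If no n worked, compactness would give a Morley
sequence of length ω + ω and a c such that the first block lies in the fiber over c and the second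
outside it, so the fiber would be neither finite nor cofinite on the sequence. -/
theorem exists_forall_isMorleyOn_defMem (h𝕄 : IsMonster L 𝕄 κ) (hA : #A < κ)
    {p : GlobalType L 𝕄 (Fin m)} (hp : IsInvariant A p) (hgs : MorleyFinCofin A p) {k : ℕ}
    {R : Set (Fin m ⊕ Fin k → 𝕄)} (hR : (∅ : Set 𝕄).Definable L R) :
    ∃ n, ∀ f : Fin n → Fin m → 𝕄, IsMorleyOn A p f → ∀ c : Fin k → 𝕄,
      (∀ i, Sum.elim (f i) c ∈ R) → DefMem p {x | Sum.elim x c ∈ R} := by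
  by_contra! hn
  obtain ⟨s, hs⟩ := exists_isMorleyOn h𝕄 hA p (Set.Iio (Ordinal.omega0.{w} + Ordinal.omega0.{w}))
  let l (i : ℕ) : Set.Iio (Ordinal.omega0.{w} + Ordinal.omega0.{w}) :=
    ⟨i, (Ordinal.natCast_lt_omega0 i).trans_le (le_self_add)⟩
  let r (i : ℕ) : Set.Iio (Ordinal.omega0.{w} + Ordinal.omega0.{w}) :=
    ⟨Ordinal.omega0 + i, by simp [Ordinal.natCast_lt_omega0]⟩
  have hfin : ∀ n : ℕ, ∃ z : Fin k → 𝕄, ∀ i < n,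
      Sum.elim (s (l i)) z ∈ R ∧ Sum.elim (s (r i)) z ∉ R := by
    intro n
    obtain ⟨f, hf, c, hfc, hc⟩ := hn n
    obtain ⟨a, ha, haf, hac⟩ := exists_extend_isMorleyOn h𝕄 hA hf c
    -- Some z separates the first n tuples from the last n. The counterexample c is quantified away,
    -- so W can be carried to any Morley sequence of length 2n.
    let W : Set (Fin (n + n) × Fin m → 𝕄) := {w | ∃ z : Fin k → 𝕄, Sum.elim w z ∈
      ⋂ i : Fin (n + n), {v | i.1 < n ↔ v ∘ Sum.map (fun x => (i, x)) id ∈ R}}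
    have hW : (∅ : Set 𝕄).Definable L W := by
      refine Set.Definable.exists_of_finite (Set.definable_iInter_of_finite fun i => ?_)
      have := hR.preimage_comp (Sum.map (fun x => (i, x)) id :
        Fin m ⊕ Fin k → (Fin (n + n) × Fin m) ⊕ Fin k)
      by_cases hi : i.1 < n
      · simp only [hi, true_iff]
        exact this
      · simp only [hi, false_iff]
        exact this.compl
    have hmem : ∀ g : Fin (n + n) → Fin m → 𝕄, Function.uncurry g ∈ W ↔
        ∃ z : Fin k → 𝕄, ∀ i, (i.1 < n ↔ Sum.elim (g i) z ∈ R) := by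
      intro g
      simp only [W, Set.mem_ofPred_eq, Set.mem_iInter]
      refine exists_congr fun z => forall_congr' fun i => ?_
      refine iff_of_eq (congrArg (fun v => (i.1 < n ↔ v ∈ R)) ?_)
      ext (x | j) <;> simp
    have h₁ : Function.uncurry (a ∘ (fun i : Fin (n + n) => i.1)) ∈ W := by
      refine (hmem _).2 ⟨c, fun i => ⟨fun hi => ?_, fun hi => ?_⟩⟩
      · have := haf ⟨i, hi⟩
        simp only at this
        rw [Function.comp_apply, this]
        exact hfc _
      · by_contra hin
        refine hc (((hac i.1 (not_lt.1 hin)).mem_iff (S := {x | Sum.elim x c ∈ R})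
          (definable_fiber hR c (Set.empty_subset _) Set.subset_union_right)).1 hi)
    -- The first n terms of each of the two blocks.
    let e : Fin (n + n) → Set.Iio (Ordinal.omega0.{w} + Ordinal.omega0.{w}) :=
      fun i => if i.1 < n then l i else r (i - n)
    have he : StrictMono e := by
      intro i j hij
      have hij' : i.1 < j.1 := hij
      simp only [e]
      split_ifs with hi hj hj
      · exact Subtype.mk_lt_mk.2 (by simpa using hij')
      · exact Subtype.mk_lt_mk.2
          ((Ordinal.natCast_lt_omega0 i).trans_le (le_self_add))
      · omega
      · refine Subtype.mk_lt_mk.2 ?_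
        have : i.1 - n < j.1 - n := by omega
        exact (add_lt_add_iff_left _).2 (Nat.cast_lt.2 this)
    have h₂ := (IsMorleyOn.sameType hp (ha.comp (e := fun i : Fin (n + n) => i.1)
      fun i j h => h) (hs.comp he) W (hW.mono (Set.empty_subset _))).1 h₁
    obtain ⟨z, hz⟩ := (hmem _).1 h₂
    refine ⟨z, fun i hi => ⟨?_, fun h => ?_⟩⟩
    · have := (hz ⟨i, by omega⟩).1 hi
      simpa [e, hi] using this
    · have := (hz ⟨n + i, by omega⟩).2 (by simpa [e] using h)
      simp at this
  let G (n : ℕ) : Set (Fin k → 𝕄) :=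
    {z | ∀ i < n, Sum.elim (s (l i)) z ∈ R ∧ Sum.elim (s (r i)) z ∉ R}
  have hfib : ∀ i, (⋃ i, Set.range (s i)).Definable L {z : Fin k → 𝕄 | Sum.elim (s i) z ∈ R} := by
    intro i
    have := definable_fiber (hR.preimage_comp (Sum.swap : Fin m ⊕ Fin k → Fin k ⊕ Fin m)) (s i)
      (Set.empty_subset _) (Set.subset_iUnion (fun i => Set.range (s i)) i)
    convert! this using 1
    ext z
    refine iff_of_eq (congrArg (· ∈ R) ?_)
    ext (x | j) <;> rfl
  have hG : ∀ n, (⋃ i, Set.range (s i)).Definable L (G n) := by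
    intro n
    have : G n = ⋂ i : Fin n, ({z | Sum.elim (s (l i)) z ∈ R} ∩
        {z | Sum.elim (s (r i)) z ∈ R}ᶜ) := by
      ext z
      simp only [G, Set.mem_ofPred_eq, Set.mem_iInter, Set.mem_inter_iff, Set.mem_compl_iff]
      exact ⟨fun h i => h i i.2, fun h i hi => h ⟨i, hi⟩⟩
    rw [this]
    exact Set.definable_iInter_of_finite fun i => (hfib _).inter (hfib _).compl
  obtain ⟨c, hc⟩ := exists_mem_directed h𝕄 (B := ⋃ i, Set.range (s i))
    (mk_lt_of_countable h𝕄 (Set.countable_iUnion fun _ => Set.countable_range _))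
    (F := Set.range G) (Set.range_nonempty G) (by
      rintro _ ⟨n, rfl⟩
      exact hG n) (by
      rintro _ ⟨n, rfl⟩ _ ⟨n', rfl⟩
      exact ⟨_, ⟨max n n', rfl⟩, fun z hz => ⟨fun i hi => hz i (lt_max_of_lt_left hi),
        fun i hi => hz i (lt_max_of_lt_right hi)⟩⟩) (by
      rintro _ ⟨n, rfl⟩
      exact hfin n)
  obtain ⟨φ, hφ⟩ := definable_fiber (B := Set.univ) hR c (Set.empty_subset _) (Set.subset_univ _)
  have hφ' : ∀ x, Sum.elim x c ∈ R ↔ φ.Realize x := fun x => Set.ext_iff.1 hφ x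
  have hl : Function.Injective l := fun i j h =>
    Nat.cast_injective (congrArg Subtype.val h)
  have hr : Function.Injective r := fun i j h => by simpa [r] using h
  obtain h | h := hgs _ (le_self_add) s hs φ
  · refine Set.infinite_range_of_injective hl (h.subset ?_)
    rintro _ ⟨i, rfl⟩
    exact (hφ' _).1 (hc _ ⟨i + 1, rfl⟩ i (Nat.lt_succ_self i)).1
  · refine Set.infinite_range_of_injective hr (h.subset ?_)
    rintro _ ⟨i, rfl⟩
    exact fun h => (hc _ ⟨i + 1, rfl⟩ i (Nat.lt_succ_self i)).2 ((hφ' _).2 h)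

end Morley

/-! ### Definability of generically stable types -/

section Definability

variable {L : FirstOrder.Language.{u, v}} {𝕄 : Type w} [L.Structure 𝕄] [Nonempty 𝕄]
  {A B : Set 𝕄} {κ : Cardinal.{w}} {m : ℕ}

/-- A generically stable type is defined by a majority rule along a Morley sequence. -/
theorem exists_definable_defMem (h𝕄 : IsMonster L 𝕄 κ) {p : GlobalType L 𝕄 (Fin m)}
    (hgs : IsGenericallyStable κ p) {k : ℕ} {R : Set (Fin m ⊕ Fin k → 𝕄)}
    (hR : (∅ : Set 𝕄).Definable L R) :
    ∃ B : Set 𝕄, #B < κ ∧ B.Definable L {z : Fin k → 𝕄 | DefMem p {x | Sum.elim x z ∈ R}} := by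
  classical
  obtain ⟨-, A, hA, hp, hgs⟩ := hgs
  obtain ⟨n₁, h₁⟩ := exists_forall_isMorleyOn_defMem h𝕄 hA hp hgs hR
  obtain ⟨n₂, h₂⟩ := exists_forall_isMorleyOn_defMem h𝕄 hA hp hgs hR.compl
  obtain ⟨s, hs⟩ := exists_isMorleyOn h𝕄 hA p (Fin (n₁ + n₂))
  refine ⟨⋃ i, Set.range (s i),
    mk_lt_of_countable h𝕄 (Set.countable_iUnion fun _ => Set.countable_range _), ?_⟩
  -- Among n₁ + n₂ terms, either n₁ lie in the fiber or n₂ lie in its complement, and each case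
  -- decides membership in `p`.
  have hD : {z : Fin k → 𝕄 | DefMem p {x | Sum.elim x z ∈ R}} =
      ⋃ e : Fin n₁ ↪o Fin (n₁ + n₂), ⋂ j, {z | Sum.elim (s (e j)) z ∈ R} := by
    ext z
    simp only [Set.mem_ofPred_eq, Set.mem_iUnion, Set.mem_iInter]
    constructor
    · intro hz
      let I : Finset (Fin (n₁ + n₂)) := {i | Sum.elim (s i) z ∈ R}
      by_cases hI : n₁ ≤ I.card
      · refine ⟨I.orderEmbOfCardLe hI, fun j => ?_⟩
        simpa [I] using I.orderEmbOfCardLe_mem hI j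
      · have hI' : n₂ ≤ Iᶜ.card := by
          rw [Finset.card_compl, Fintype.card_fin]
          omega
        have := h₂ (s ∘ Iᶜ.orderEmbOfCardLe hI') (hs.comp (OrderEmbedding.strictMono _)) z
          fun j => by simpa [I] using Iᶜ.orderEmbOfCardLe_mem hI' j
        refine absurd hz ((DefMem.compl_iff ?_).1 this)
        exact definable_fiber hR z (Set.empty_subset _) (Set.subset_univ _)
    · rintro ⟨e, he⟩
      exact h₁ (s ∘ e) (hs.comp e.strictMono) z he
  rw [hD]
  refine Set.definable_iUnion_of_finite fun e => Set.definable_iInter_of_finite fun j => ?_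
  have := definable_fiber (hR.preimage_comp (Sum.swap : Fin m ⊕ Fin k → Fin k ⊕ Fin m)) (s (e j))
    (Set.empty_subset _) (Set.subset_iUnion (fun i => Set.range (s i)) (e j))
  convert! this using 1
  ext z
  refine iff_of_eq (congrArg (· ∈ R) ?_)
  ext (x | j) <;> rfl

/-- A generically stable type that is invariant over a small set `A` is definable over `A`. -/
theorem definable_defMem (h𝕄 : IsMonster L 𝕄 κ) {p : GlobalType L 𝕄 (Fin m)}
    (hgs : IsGenericallyStable κ p) (hA : #A < κ) (hp : IsInvariant A p) {β : Type w₁} [Finite β]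
    {R : Set (Fin m ⊕ β → 𝕄)} (hR : A.Definable L R) :
    A.Definable L {z : β → 𝕄 | DefMem p {x | Sum.elim x z ∈ R}} := by
  obtain ⟨l, c, R₀, hc, hR₀, rfl⟩ := exists_eq_fiber hR
  -- The parameters c are treated as further variables, since the majority rule is for relations
  -- without parameters. They are substituted back at the end.
  obtain ⟨k, ⟨e⟩⟩ := Finite.exists_equiv_fin (β ⊕ Fin l)
  let g : (Fin m ⊕ β) ⊕ Fin l → Fin m ⊕ Fin k :=
    Sum.elim (Sum.elim Sum.inl fun b => Sum.inr (e (Sum.inl b))) fun j => Sum.inr (e (Sum.inr j))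
  have hR₁ := hR₀.preimage_comp g
  obtain ⟨B, hB, hD⟩ := exists_definable_defMem h𝕄 hgs hR₁
  have hD' := definable_of_invariant h𝕄 hA hB hD fun c c' hcc' =>
    (hp.defMem_iff (hR₁.mono (Set.empty_subset _)) hcc').1
  have := definable_fiber (hD'.preimage_comp e.symm) c subset_rfl hc
  convert! this using 1
  ext z
  simp only [Set.mem_ofPred_eq, Set.mem_preimage]
  refine iff_of_eq (congrArg (DefMem p) ?_)
  ext x
  refine iff_of_eq (congrArg (· ∈ R₀) ?_)
  ext ((i | b) | j) <;> simp [g]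

/-- Weak orthogonality over a set `C` containing a small model `M` descends to `M`. -/
theorem exists_defMem_descend (h𝕄 : IsMonster L 𝕄 κ) {n : ℕ} (M : L.ElementarySubstructure 𝕄)
    (hM : #M < κ) {p : GlobalType L 𝕄 (Fin m)} {q : GlobalType L 𝕄 (Fin n)}
    (hp : IsInvariant (M : Set 𝕄) p) (hq : IsInvariant (M : Set 𝕄) q)
    (hp_gs : IsGenericallyStable κ p) (hq_gs : IsGenericallyStable κ q)
    {R : Set (Fin m ⊕ Fin n → 𝕄)} (hR : (M : Set 𝕄).Definable L R)
    {S : Set (Fin m → 𝕄)} {S' : Set (Fin n → 𝕄)} (hS : DefMem p S) (hS' : DefMem q S')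
    (h : ∀ x ∈ S, ∀ y ∈ S', Sum.elim x y ∈ R) :
    ∃ S S', DefMem (restrict p (M : Set 𝕄)) S ∧ DefMem (restrict q (M : Set 𝕄)) S' ∧
      ∀ x ∈ S, ∀ y ∈ S', Sum.elim x y ∈ R := by
  obtain ⟨k, c, S₀, -, hS₀, rfl⟩ := exists_eq_fiber hS.definable
  obtain ⟨k', c', S₀', -, hS₀', rfl⟩ := exists_eq_fiber hS'.definable
  have hM₀ : ∀ {γ : Type} {U : Set (γ → 𝕄)}, (∅ : Set 𝕄).Definable L U →
      (M : Set 𝕄).Definable L U := fun hU => hU.mono (Set.empty_subset _)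
  have hD := (definable_defMem h𝕄 hp_gs hM hp (hM₀ hS₀)).preimage_comp
    (Sum.inl : Fin k → Fin k ⊕ Fin k')
  have hD' := (definable_defMem h𝕄 hq_gs hM hq (hM₀ hS₀')).preimage_comp
    (Sum.inr : Fin k' → Fin k ⊕ Fin k')
  -- Quantifying V over x and y says that the product of the fibers over z and z' lies in R.
  -- Together with membership of these fibers in `p` and `q` this is an M-definable condition on (z,
  -- z'), which (c, c') satisfies.
  let V : Set ((Fin k ⊕ Fin k') ⊕ (Fin m ⊕ Fin n) → 𝕄) :=
    (((fun v => v ∘ Sum.elim (Sum.inr ∘ Sum.inl) (Sum.inl ∘ Sum.inl)) ⁻¹' S₀)ᶜ ∪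
      ((fun v => v ∘ Sum.elim (Sum.inr ∘ Sum.inr) (Sum.inl ∘ Sum.inr)) ⁻¹' S₀')ᶜ) ∪
      ((fun v => v ∘ Sum.inr) ⁻¹' R)
  have hV : (M : Set 𝕄).Definable L V :=
    ((((hM₀ hS₀).preimage_comp _).compl).union ((hM₀ hS₀').preimage_comp _).compl).union
      (hR.preimage_comp _)
  have hVm : ∀ z z' x y, Sum.elim (Sum.elim z z') (Sum.elim x y) ∈ V ↔
      (Sum.elim x z ∈ S₀ → Sum.elim y z' ∈ S₀' → Sum.elim x y ∈ R) := by
    intro z z' x y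
    simp only [V, Set.mem_union, Set.mem_compl_iff, Set.mem_preimage, Sum.comp_elim,
      ← Function.comp_assoc, Sum.elim_comp_inl, Sum.elim_comp_inr]
    tauto
  obtain ⟨d, ⟨⟨hd₁, hd₂⟩, hd₃⟩, hdM⟩ := exists_mem_elementarySubstructure M
    ((hD.inter hD').inter hV.forall_of_finite) ⟨Sum.elim c c', ⟨hS, hS'⟩, fun u => by
      rw [← Sum.elim_comp_inl_inr u]
      exact (hVm _ _ _ _).2 fun hx hy => h _ hx _ hy⟩
  refine ⟨{x | Sum.elim x (d ∘ Sum.inl) ∈ S₀}, {y | Sum.elim y (d ∘ Sum.inr) ∈ S₀'},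
    defMem_restrict.2 ⟨definable_fiber hS₀ _ (Set.empty_subset _) ?_, hd₁⟩,
    defMem_restrict.2 ⟨definable_fiber hS₀' _ (Set.empty_subset _) ?_, hd₂⟩,
    fun x hx y hy => (hVm _ _ _ _).1 ?_ hx hy⟩
  · rintro _ ⟨i, rfl⟩
    exact hdM _
  · rintro _ ⟨i, rfl⟩
    exact hdM _
  · rw [Sum.elim_comp_inl_inr]
    exact hd₃ _

/-- The parameters of S and S' are unrestricted in the hypothesis, so it covers both global types
and restrictions to a larger small set. -/
theorem weaklyOrthogonal_restrict_model (h𝕄 : IsMonster L 𝕄 κ) {n : ℕ}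
    (M : L.ElementarySubstructure 𝕄) (hM : #M < κ)
    {p : GlobalType L 𝕄 (Fin m)} {q : GlobalType L 𝕄 (Fin n)}
    (hp : IsInvariant (M : Set 𝕄) p) (hq : IsInvariant (M : Set 𝕄) q)
    (hp_gs : IsGenericallyStable κ p) (hq_gs : IsGenericallyStable κ q)
    (h : ∀ R : Set (Fin m ⊕ Fin n → 𝕄), (M : Set 𝕄).Definable L R →
      ∃ S S', DefMem p S ∧ DefMem q S' ∧
        ((∀ x ∈ S, ∀ y ∈ S', Sum.elim x y ∈ R) ∨ ∀ x ∈ S, ∀ y ∈ S', Sum.elim x y ∉ R)) :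
    WeaklyOrthogonal (restrict p (M : Set 𝕄)) (restrict q (M : Set 𝕄)) := by
  refine weaklyOrthogonal_iff.2 fun R hR => ?_
  obtain ⟨S, S', hS, hS', hSS' | hSS'⟩ := h R hR
  · obtain ⟨U, U', hU, hU', hUU'⟩ :=
      exists_defMem_descend h𝕄 M hM hp hq hp_gs hq_gs hR hS hS' hSS'
    exact ⟨U, U', hU, hU', Or.inl hUU'⟩
  · obtain ⟨U, U', hU, hU', hUU'⟩ :=
      exists_defMem_descend h𝕄 M hM hp hq hp_gs hq_gs hR.compl hS hS' hSS'
    exact ⟨U, U', hU, hU', Or.inr hUU'⟩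

end Definability

/-! ### Strong regularity and the passage from M to global types -/

section Regularity

variable {L : FirstOrder.Language.{u, v}} {𝕄 : Type w} [L.Structure 𝕄] [Nonempty 𝕄]
  {A B : Set 𝕄} {κ : Cardinal.{w}} {m n k : ℕ}

/-- The dichotomy of strong regularity, for all small sets containing `N`. -/
def RegularAbove (κ : Cardinal.{w}) (N : Set 𝕄) (p : GlobalType L 𝕄 (Fin m))
    (U : Set (Fin m → 𝕄)) : Prop :=
  ∀ B : Set 𝕄, N ⊆ B → #B < κ → ∀ a ∈ U, Realizes a (restrict p B) ∨
    ∀ a', Realizes a' (restrict p B) → Realizes a' (restrict p (B ∪ Set.range a))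

/-- Adding finitely many non-generic elements does not change the set of realizations. -/
theorem RegularAbove.realizes_union (h𝕄 : IsMonster L 𝕄 κ) {N : Set 𝕄}
    {p : GlobalType L 𝕄 (Fin m)} {U : Set (Fin m → 𝕄)} (hp : RegularAbove κ N p U) (hNB : N ⊆ B)
    (hB : #B < κ) {a' : Fin m → 𝕄} (ha' : Realizes a' (restrict p B)) (a : ℕ → Fin m → 𝕄) (i : ℕ)
    (ha : ∀ j < i, a j ∈ U ∧ ¬ Realizes (a j) (restrict p B)) :
    Realizes a' (restrict p (B ∪ elementsBefore a i)) := by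
  induction i with
  | zero =>
    have : elementsBefore a 0 = ∅ := by
      ext c
      simp [elementsBefore]
    rwa [this, Set.union_empty]
  | succ i ih =>
    obtain ⟨haU, hai⟩ := ha i i.lt_succ_self
    have hlt : #(B ∪ elementsBefore a i : Set 𝕄) < κ :=
      mk_union_lt h𝕄 hB (mk_lt_of_countable h𝕄 (countable_elementsBefore a i))
    -- A tuple that is not generic over B is not generic over a larger set, which rules out the
    -- first alternative.
    obtain h | h := hp _ (hNB.trans Set.subset_union_left) hlt (a i) haU
    · exact absurd (h.mono_set Set.subset_union_left) hai
    · refine (h a' (ih fun j hj => ha j (hj.trans i.lt_succ_self))).mono_set ?_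
      rintro c (hc | ⟨j, hj, hc⟩)
      · exact Or.inl (Or.inl hc)
      · obtain hj | rfl := Nat.lt_succ_iff_lt_or_eq.1 hj
        · exact Or.inl (Or.inr ⟨j, hj, hc⟩)
        · exact Or.inr hc

/-- If `p ↾ M` and `q ↾ M` are weakly orthogonal, then a relation that meets all products of
formulas of `p` and `q` has generic fibers in `p`. -/
theorem defMem_of_meets (h𝕄 : IsMonster L 𝕄 κ) (M : L.ElementarySubstructure 𝕄)
    (hM : #M < κ) {p : GlobalType L 𝕄 (Fin m)} {q : GlobalType L 𝕄 (Fin n)}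
    (hp : IsInvariant (M : Set 𝕄) p) (hp_gs : IsGenericallyStable κ p)
    {U : Set (Fin m → 𝕄)} (hU : (M : Set 𝕄).Definable L U) (hpU : DefMem p U)
    {U' : Set (Fin n → 𝕄)} (hU' : (M : Set 𝕄).Definable L U') (hqU' : DefMem q U')
    (horth : WeaklyOrthogonal (restrict p (M : Set 𝕄)) (restrict q (M : Set 𝕄)))
    {N : Set 𝕄} (hA : #A < κ) (hAN : A ⊆ N) (hpA : IsInvariant A p) (hgs : MorleyFinCofin A p)
    (hN : #N < κ) (hMN : (M : Set 𝕄) ⊆ N)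
    (hp_reg : RegularAbove κ N p U) (hq_reg : RegularAbove κ N q U')
    {R : Set (Fin m ⊕ (Fin n ⊕ Fin k) → 𝕄)} (hR : (∅ : Set 𝕄).Definable L R)
    {d : Fin k → 𝕄} (hd : Set.range d ⊆ N)
    (hmeet : ∀ S S', DefMem p S → DefMem q S' →
      ∃ x ∈ S, ∃ y ∈ S', Sum.elim x (Sum.elim y d) ∈ R)
    {b : Fin n → 𝕄} (hb : Realizes b (restrict q N)) :
    DefMem p {x | Sum.elim x (Sum.elim b d) ∈ R} := by
  by_contra hbR
  have hRM : (M : Set 𝕄).Definable L R := hR.mono (Set.empty_subset _)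
  have hfib : ∀ w : Fin n ⊕ Fin k → 𝕄, (Set.univ : Set 𝕄).Definable L {x | Sum.elim x w ∈ R} :=
    fun w => definable_fiber hR w (Set.empty_subset _) (Set.subset_univ _)
  have hE := (definable_defMem h𝕄 hp_gs hM hp hRM).compl
  -- X(x, z) says that x has a partner y in U' with R(x, y, z), although the fiber over (y, z) is
  -- not in `p`. It is definable over M because `p` is.
  let X : Set (Fin m ⊕ Fin k → 𝕄) := {u | ∃ y : Fin n → 𝕄, Sum.elim u y ∈
    ((fun v : (Fin m ⊕ Fin k) ⊕ Fin n → 𝕄 => v ∘ Sum.inr) ⁻¹' U' ∩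
      (fun v => v ∘ Sum.elim (Sum.inl ∘ Sum.inl) (Sum.elim Sum.inr (Sum.inl ∘ Sum.inr))) ⁻¹' R) ∩
      (fun v => v ∘ Sum.elim Sum.inr (Sum.inl ∘ Sum.inr)) ⁻¹'
        {z | DefMem p {x | Sum.elim x z ∈ R}}ᶜ}
  have hX : (M : Set 𝕄).Definable L X :=
    (((hU'.preimage_comp _).inter (hRM.preimage_comp _)).inter
      (hE.preimage_comp _)).exists_of_finite
  have hXm : ∀ x z, Sum.elim x z ∈ X ↔ ∃ y ∈ U', Sum.elim x (Sum.elim y z) ∈ R ∧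
      ¬ DefMem p {x | Sum.elim x (Sum.elim y z) ∈ R} := by
    intro x z
    simp only [X, Set.mem_ofPred_eq, Set.mem_inter_iff, Set.mem_preimage, Set.mem_compl_iff,
      Sum.comp_elim, ← Function.comp_assoc, Sum.elim_comp_inl, Sum.elim_comp_inr, and_assoc]
  have hXd : DefMem p {x | Sum.elim x d ∈ X} := by
    have hXdef : (Set.univ : Set 𝕄).Definable L {x | Sum.elim x d ∈ X} :=
      definable_fiber hX d (Set.subset_univ _) (Set.subset_univ _)
    -- Since b realizes q over N, the set of y in U' whose fiber is not in `p` belongs to `q`. By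
    -- `hmeet` it has a point related by R to a point outside X.
    by_contra hn
    have hE' : N.Definable L {y : Fin n → 𝕄 | y ∈ U' ∧
        ¬ DefMem p {x | Sum.elim x (Sum.elim y d) ∈ R}} :=
      (hU'.mono hMN).inter (definable_fiber hE d hMN hd)
    have hbE := (hb.mem_iff hE').1 ⟨(hb.mem_iff (hU'.mono hMN)).2 hqU', hbR⟩
    obtain ⟨x, hx, y, hy, hxy⟩ := hmeet _ _ ((DefMem.compl_iff hXdef).2 hn) hbE
    exact hx ((hXm x d).2 ⟨y, hy.1, hxy, hy.2⟩)
  obtain ⟨d', hd', hd'M⟩ := exists_mem_elementarySubstructure M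
    (definable_defMem h𝕄 hp_gs hM hp hX) ⟨d, hXd⟩
  replace hd'M : Set.range d' ⊆ (M : Set 𝕄) := by
    rintro _ ⟨i, rfl⟩
    exact hd'M i
  have hpartner : ∀ a, Realizes a (restrict p (M : Set 𝕄)) → ∃ b' ∈ U',
      ¬ Realizes b' (restrict q (M : Set 𝕄)) ∧
      ¬ Realizes a (restrict p ((M : Set 𝕄) ∪ Set.range b')) := by
    intro a ha
    obtain ⟨b', hb'U, hab', hb'R⟩ := (hXm a d').1 ((ha.mem_iff (S := {x | Sum.elim x d' ∈ X})
      (definable_fiber hX d' subset_rfl hd'M)).2 hd')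
    refine ⟨b', hb'U, fun hb' => hb'R ?_, fun ha' => hb'R ((ha'.mem_iff
      (S := {x | Sum.elim x (Sum.elim b' d') ∈ R}) (definable_fiber hR _ (Set.empty_subset _)
        ?_)).1 hab')⟩
    -- If b' realized q over M, weak orthogonality would let R(a, b', d') hold only by holding on a
    -- whole product S × S', so the fiber over b' would be in `p`.
    · let R' : Set (Fin m ⊕ Fin n → 𝕄) := {v | Sum.elim v d' ∈
        (fun u => u ∘ (Equiv.sumAssoc (Fin m) (Fin n) (Fin k)).symm) ⁻¹' R}
      have hR' : (M : Set 𝕄).Definable L R' :=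
        definable_fiber (hRM.preimage_comp _) d' subset_rfl hd'M
      have hR'm : ∀ x y, Sum.elim x y ∈ R' ↔ Sum.elim x (Sum.elim y d') ∈ R := by
        intro x y
        refine iff_of_eq (congrArg (· ∈ R) ?_)
        ext (i | i | i) <;> rfl
      obtain ⟨S, S', hS, hS', hSS'⟩ := weaklyOrthogonal_iff.1 horth R' hR'
      rw [defMem_restrict] at hS hS'
      have haS := (ha.mem_iff hS.1).2 hS.2
      have hbS := (hb'.mem_iff hS'.1).2 hS'.2
      obtain h | h := hSS'
      · exact hS.2.mono (hfib _) fun x hx => (hR'm x b').1 (h x hx b' hbS)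
      · exact absurd ((hR'm a b').2 hab') (h a haS b' hbS)
    · rintro _ ⟨i | i, rfl⟩
      · exact Or.inr ⟨i, rfl⟩
      · exact Or.inl (hd'M ⟨i, rfl⟩)
  -- The recursion must answer arbitrary histories, so the requirement is conditional on b still
  -- being generic over the earlier partners. The condition is checked afterwards, in `hbi`.
  obtain ⟨f, hf⟩ := exists_wellFounded_choice (ι := ℕ) (X := (Fin m → 𝕄) × (Fin n → 𝕄))
    (fun i g x => Realizes b (restrict q (N ∪ {c | ∃ j, ∃ hj : j < i, c ∈ Set.range (g j hj).2})) →
      Realizes x.1 (restrict p (N ∪ {c | ∃ j, ∃ hj : j < i, c ∈ Set.range (g j hj).2})) ∧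
      Sum.elim x.1 (Sum.elim b d) ∈ R ∧ x.2 ∈ U' ∧
      ¬ Realizes x.2 (restrict q (M : Set 𝕄)) ∧
      ¬ Realizes x.1 (restrict p ((M : Set 𝕄) ∪ Set.range x.2))) (by
    intro i g
    set N' := N ∪ {c | ∃ j, ∃ hj : j < i, c ∈ Set.range (g j hj).2} with hN'
    by_cases hbN : Realizes b (restrict q N')
    swap
    · exact ⟨Classical.arbitrary _, fun h => absurd h hbN⟩
    have hN'κ : #N' < κ := by
      refine mk_union_lt h𝕄 hN (mk_lt_of_countable h𝕄 ?_)
      have : {c | ∃ j, ∃ hj : j < i, c ∈ Set.range (g j hj).2} =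
          ⋃ j : {j // j < i}, Set.range (g j.1 j.2).2 := by
        ext c
        simp
      rw [this]
      exact Set.countable_iUnion fun _ => Set.countable_range _
    obtain ⟨a, haR, ha⟩ := exists_realizes_restrict_inter h𝕄 hN'κ p
      (A := Set.range (Sum.elim b d)) (S := {x | Sum.elim x (Sum.elim b d) ∈ R})
      (definable_fiber hR _ (Set.empty_subset _) subset_rfl)
      (mk_lt_of_countable h𝕄 (Set.countable_range _)) (by
        intro S hS hpS
        -- That S meets the fiber over (y, d) is a condition on y over N'. By `hmeet` it belongs to
        -- `q`, so b satisfies it.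
        let Y : Set (Fin n ⊕ Fin k → 𝕄) := {w | ∃ x : Fin m → 𝕄, Sum.elim w x ∈
          (fun v => v ∘ Sum.inr) ⁻¹' S ∩ (fun v => v ∘ Sum.swap) ⁻¹' R}
        have hY : N'.Definable L Y :=
          ((hS.preimage_comp _).inter
            ((hR.mono (Set.empty_subset _)).preimage_comp _)).exists_of_finite
        have hYm : ∀ w, w ∈ Y ↔ ∃ x ∈ S, Sum.elim x w ∈ R := by
          intro w
          simp only [Y, Set.mem_ofPred_eq, Set.mem_inter_iff, Set.mem_preimage,
            Sum.elim_comp_inr]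
          refine exists_congr fun x => and_congr Iff.rfl (iff_of_eq (congrArg (· ∈ R) ?_))
          ext (i | i) <;> rfl
        have hYd : N'.Definable L {y : Fin n → 𝕄 | Sum.elim y d ∈ Y} :=
          definable_fiber hY d subset_rfl (hd.trans Set.subset_union_left)
        have hYq : DefMem q {y : Fin n → 𝕄 | Sum.elim y d ∈ Y} := by
          by_contra hn
          obtain ⟨x, hx, y, hy, hxy⟩ := hmeet _ _ hpS
            ((DefMem.compl_iff (hYd.mono (Set.subset_univ _))).2 hn)
          exact hy ((hYm _).2 ⟨x, hx, hxy⟩)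
        obtain ⟨x, hx, hxR⟩ := (hYm _).1 ((hbN.mem_iff hYd).2 hYq)
        exact ⟨x, hx, hxR⟩)
    obtain ⟨b', hb'U, hb', hab'⟩ := hpartner a
      (ha.mono_set (hMN.trans Set.subset_union_left))
    exact ⟨(a, b'), fun _ => ⟨ha, haR, hb'U, hb', hab'⟩⟩)
  let a : ℕ → Fin m → 𝕄 := fun i => (f i).1
  let b' : ℕ → Fin n → 𝕄 := fun i => (f i).2
  have hset : ∀ i : ℕ, {c | ∃ j, ∃ _ : j < i, c ∈ Set.range (f j).2} = elementsBefore b' i := by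
    intro i
    ext c
    simp [elementsBefore, b']
  replace hf : ∀ i, Realizes b (restrict q (N ∪ elementsBefore b' i)) →
      Realizes (a i) (restrict p (N ∪ elementsBefore b' i)) ∧
      Sum.elim (a i) (Sum.elim b d) ∈ R ∧ b' i ∈ U' ∧
      ¬ Realizes (b' i) (restrict q (M : Set 𝕄)) ∧
      ¬ Realizes (a i) (restrict p ((M : Set 𝕄) ∪ Set.range (b' i))) :=
    fun i => hset i ▸ hf i
  have hbi : ∀ i, Realizes b (restrict q (N ∪ elementsBefore b' i)) := by
    intro i
    induction i using Nat.strong_induction_on with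
    | _ i ih =>
      refine hq_reg.realizes_union h𝕄 subset_rfl hN hb b' i fun j hj => ?_
      obtain ⟨-, -, hU, hnq, -⟩ := hf j (ih j hj)
      exact ⟨hU, fun h => hnq (h.mono_set hMN)⟩
  -- Each earlier a_j satisfies U but is not generic over N b'_{<i}, which contains its partner
  -- b'_j. Regularity therefore adds a_{<i} to the base for free.
  have hmorley : IsMorleyOn N p a := by
    intro i
    have := hp_reg.realizes_union h𝕄 (B := N ∪ elementsBefore b' i) Set.subset_union_left
      (mk_union_lt h𝕄 hN (mk_lt_of_countable h𝕄 (countable_elementsBefore b' i)))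
      (hf i (hbi i)).1 a i fun j hj => by
        obtain ⟨ha, -, -, -, hnp⟩ := hf j (hbi j)
        refine ⟨(ha.mem_iff (hU.mono (hMN.trans Set.subset_union_left))).2 hpU,
          fun h => hnp (h.mono_set ?_)⟩
        exact Set.union_subset_union hMN fun c hc => ⟨j, hj, hc⟩
    exact this.mono_set (Set.union_subset_union_left _ Set.subset_union_left)
  obtain ⟨l, hl⟩ := exists_forall_isMorleyOn_defMem h𝕄 hA hpA hgs
    (hR.preimage_comp (Sum.map id finSumFinEquiv : Fin m ⊕ (Fin n ⊕ Fin k) → Fin m ⊕ Fin (n + k)))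
  have hmem : ∀ x : Fin m → 𝕄, Sum.elim x (Sum.elim b d ∘ finSumFinEquiv.symm) ∈
      (fun v => v ∘ (Sum.map id finSumFinEquiv :
        Fin m ⊕ (Fin n ⊕ Fin k) → Fin m ⊕ Fin (n + k))) ⁻¹' R ↔
      Sum.elim x (Sum.elim b d) ∈ R := by
    intro x
    refine iff_of_eq (congrArg (· ∈ R) ?_)
    ext (i | i) <;> simp
  have := hl (a ∘ Fin.val) ((hmorley.mono_set hAN).comp Fin.val_strictMono)
    (Sum.elim b d ∘ finSumFinEquiv.symm) fun i => (hmem _).2 (hf i (hbi i)).2.1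
  simp only [hmem] at this
  exact hbR this

theorem orthogonal_of_weaklyOrthogonal_restrict (h𝕄 : IsMonster L 𝕄 κ)
    (M : L.ElementarySubstructure 𝕄) (hM : #M < κ)
    {p : GlobalType L 𝕄 (Fin m)} {φp : GlobalFormula L 𝕄 (Fin m)}
    {q : GlobalType L 𝕄 (Fin n)} {φq : GlobalFormula L 𝕄 (Fin n)}
    (hp_inv : IsInvariantPair (M : Set 𝕄) p φp) (hp_reg : IsStronglyRegular κ p φp)
    (hp_gs : IsGenericallyStable κ p)
    (hq_inv : IsInvariantPair (M : Set 𝕄) q φq) (hq_reg : IsStronglyRegular κ q φq)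
    (horth : WeaklyOrthogonal (restrict p (M : Set 𝕄)) (restrict q (M : Set 𝕄))) :
    Orthogonal p q := by
  refine weaklyOrthogonal_iff.2 fun R hR => ?_
  by_contra! hn
  obtain ⟨hp, ψp, rfl, hψp⟩ := hp_inv
  obtain ⟨hq, ψq, rfl, hψq⟩ := hq_inv
  obtain ⟨-, A, hA, hpA, hgs⟩ := id hp_gs
  obtain ⟨Ap, hAp, -, hp_reg⟩ := hp_reg
  obtain ⟨Aq, hAq, -, hq_reg⟩ := hq_reg
  obtain ⟨k, d, R₀, -, hR₀, rfl⟩ := exists_eq_fiber hR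
  let N : Set 𝕄 := (M ∪ A) ∪ (Ap ∪ Aq) ∪ Set.range d
  have hN : #N < κ := mk_union_lt h𝕄 (mk_union_lt h𝕄 (mk_union_lt h𝕄 hM hA)
    (mk_union_lt h𝕄 hAp hAq)) (mk_lt_of_countable h𝕄 (Set.countable_range d))
  have hMN : (M : Set 𝕄) ⊆ N := fun x hx => Or.inl (Or.inl (Or.inl hx))
  have hAN : A ⊆ N := fun x hx => Or.inl (Or.inl (Or.inr hx))
  have hApN : Ap ⊆ N := fun x hx => Or.inl (Or.inr (Or.inl hx))
  have hAqN : Aq ⊆ N := fun x hx => Or.inl (Or.inr (Or.inr hx))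
  have hdN : Set.range d ⊆ N := Set.subset_union_right
  have hpU := defMem_restrict.1 ⟨ψp, hψp, rfl⟩
  have hqU := defMem_restrict.1 ⟨ψq, hψq, rfl⟩
  have hp_reg' : RegularAbove κ N p {x | ψp.Realize x} := fun B hB hBκ a ha =>
    hp_reg B (hApN.trans hB) hBκ a (realize_toGlobal.2 ha)
  have hq_reg' : RegularAbove κ N q {x | ψq.Realize x} := fun B hB hBκ a ha =>
    hq_reg B (hAqN.trans hB) hBκ a (realize_toGlobal.2 ha)
  obtain ⟨b, hb⟩ := exists_realizes_restrict h𝕄 hN q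
  let R₁ : Set (Fin m ⊕ (Fin n ⊕ Fin k) → 𝕄) :=
    (fun v => v ∘ Equiv.sumAssoc (Fin m) (Fin n) (Fin k)) ⁻¹' R₀
  have hR₁ : (∅ : Set 𝕄).Definable L R₁ := hR₀.preimage_comp _
  have hR₁m : ∀ x y, Sum.elim x (Sum.elim y d) ∈ R₁ ↔ Sum.elim (Sum.elim x y) d ∈ R₀ := by
    intro x y
    refine iff_of_eq (congrArg (· ∈ R₀) ?_)
    ext ((i | i) | i) <;> rfl
  -- The failure of orthogonality is symmetric in R and its complement, so both fibers over the same
  -- b fall into `p`.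
  have h₁ := defMem_of_meets h𝕄 M hM hp hp_gs hpU.1 hpU.2 hqU.1 hqU.2 horth hA hAN hpA hgs hN hMN
    hp_reg' hq_reg' hR₁ hdN (fun S S' hS hS' => by
      obtain ⟨x, hx, y, hy, hxy⟩ := (hn S S' hS hS').2
      exact ⟨x, hx, y, hy, (hR₁m x y).2 hxy⟩) hb
  have h₂ := defMem_of_meets h𝕄 M hM hp hp_gs hpU.1 hpU.2 hqU.1 hqU.2 horth hA hAN hpA hgs hN hMN
    hp_reg' hq_reg' hR₁.compl hdN (fun S S' hS hS' => by
      obtain ⟨x, hx, y, hy, hxy⟩ := (hn S S' hS hS').1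
      exact ⟨x, hx, y, hy, fun h => hxy ((hR₁m x y).1 h)⟩) hb
  obtain ⟨x, hx₁, hx₂⟩ := (h₁.inter h₂).nonempty
  exact hx₂ hx₁

end Regularity

end MonsterTypes

theorem mainTheorem4 {L : FirstOrder.Language.{u, v}} {𝕄 : Type w} [L.Structure 𝕄] [Nonempty 𝕄]
    {κ : Cardinal.{w}} (h𝕄 : IsMonster L 𝕄 κ)
    (M : L.ElementarySubstructure 𝕄) (hM : #M < κ) {m n : ℕ}
    (p : GlobalType L 𝕄 (Fin m)) (φp : GlobalFormula L 𝕄 (Fin m))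
    (q : GlobalType L 𝕄 (Fin n)) (φq : GlobalFormula L 𝕄 (Fin n))
    (hp_inv : IsInvariantPair (M : Set 𝕄) p φp) (hp_reg : IsStronglyRegular κ p φp)
    (hp_gs : IsGenericallyStable κ p)
    (hq_inv : IsInvariantPair (M : Set 𝕄) q φq) (hq_reg : IsStronglyRegular κ q φq)
    (hq_gs : IsGenericallyStable κ q) :
    List.TFAE [
      Orthogonal p q,
      WeaklyOrthogonal (restrict p (M : Set 𝕄)) (restrict q (M : Set 𝕄)),
      ∃ C : Set 𝕄, (M : Set 𝕄) ⊆ C ∧ #C < κ ∧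
        WeaklyOrthogonal (restrict p C) (restrict q C)] := by
  tfae_have 2 → 1 :=
    orthogonal_of_weaklyOrthogonal_restrict h𝕄 M hM hp_inv hp_reg hp_gs hq_inv hq_reg
  tfae_have 1 → 2 := by
    intro h
    refine weaklyOrthogonal_restrict_model h𝕄 M hM hp_inv.1 hq_inv.1 hp_gs hq_gs fun R hR => ?_
    exact weaklyOrthogonal_iff.1 h R (hR.mono (Set.subset_univ _))
  tfae_have 2 → 3 := fun h => ⟨M, subset_rfl, hM, h⟩
  tfae_have 3 → 2 := by
    rintro ⟨C, hMC, -, h⟩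
    refine weaklyOrthogonal_restrict_model h𝕄 M hM hp_inv.1 hq_inv.1 hp_gs hq_gs fun R hR => ?_
    obtain ⟨S, S', hS, hS', hSS'⟩ := weaklyOrthogonal_iff.1 h R (hR.mono hMC)
    exact ⟨S, S', (defMem_restrict.1 hS).2, (defMem_restrict.1 hS').2, hSS'⟩
  tfae_finish
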